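/- Let $R=\mathbb{C}((q))$ and $\widetilde R=\mathbb{C}[[q]]$. A variation of Hodge structures (VHS) over $R$ is a free, finite-rank $\mathbb{Z}/2$-graded $R$-module $\mathcal V=\mathcal V_{ev}\oplus\mathcal V_{odd}$ with a connection $\nabla=\nabla_{d/dq}$ on each part and decreasing filtrations by $R$-submodules, $\mathcal F^{\geq p}\mathcal V_{ev}$ ($p\in\mathbb{Z}$) and $\mathcal F^{\geq p}\mathcal V_{odd}$ ($p\in\mathbb{Z}+\frac12$), with $\nabla_{d/dq}\mathcal F^{\geq p}\subset\mathcal F^{\geq p-1}$. It is polarised if both parts carry $R$-bilinear pairings with $(\alpha,\beta)=(-1)^n(\beta,\alpha)$ for some $n\in\mathbb{Z}/2$, with $(\mathcal F^{\geq p},\mathcal F^{\geq r})=0$ for $p+r>0$, and non-degenerate on $Gr^p_{\mathcal F}\otimes Gr^{-p}_{\mathcal F}$ for all $p$. It is regular singular if it contains an $\widetilde R$-lattice stable under $\nabla_{q\,d/dq}$; its Deligne lattice $\widetilde{\mathcal V}$ is then the unique stable lattice for which the eigenvalues of the residue on $\widetilde{\mathcal V}/q\widetilde{\mathcal V}$ have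 real part in $[0,1)$, and $\widetilde{\mathcal F}^{\geq p}\widetilde{\mathcal V}:=\mathcal F^{\geq p}\mathcal V\cap\widetilde{\mathcal V}$. Fix $k\in\frac12\mathbb{Z}$ and regard $R$ as a VHS with connection $d/dq$, $\mathcal F^{\geq k}R=R$, $\mathcal F^{\geq k+1}R=0$, placed in even degree if $k\in\mathbb{Z}$ and in odd degree otherwise. An extension $0\to\mathcal V\xrightarrow{a}\mathcal W\xrightarrow{b}R\to0$ is a short exact sequence of VHS, strict for the filtrations $\mathcal F$. It is regular singular if $\mathcal V$ and $\mathcal W$ are regular singular and the sequence of filtered Deligne lattices $0\to\widetilde{\mathcal V}\to\widetilde{\mathcal W}\to\widetilde R\to0$ is exact in each step, i.e. $b(\widetilde{\mathcal F}^{\geq p}\widetilde{\mathcal W})=\widetilde{\mathcal F}^{\geq p}\widetilde R$ for all $p$. It is holomorphically flat if there is $h\in\widetilde{\mathcal W}$ with $\nabla_{q\,d/dq}h=0$ and $b(h)=1$. An isomorphism of extensions is an isomorphism of the middle VHS inducing the identity on $\mathcal V$ and $R$. Let $\mathcal V$ be a polarised, regular singular VHS over $R$, and let $$\widetilde{\mathcal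 J}^k=\widetilde{\mathcal V}/\bigl(\widetilde{\mathcal F}^{\geq k}\widetilde{\mathcal V}+\ker(\nabla_{d/dq}|_{\widetilde{\mathcal V}})\bigr),$$ where $\mathcal V$ is restricted to the parity of $R$. A normal function is an element $\nu\in\widetilde{\mathcal J}^k$ with a lift $\widetilde\nu\in\widetilde{\mathcal V}$ such that $\nabla_{q\,d/dq}\widetilde\nu\in\widetilde{\mathcal F}^{\geq k-1}\widetilde{\mathcal V}$. Proposition. There is a bijection between the set of normal functions $\nu\in\widetilde{\mathcal J}^k$ and the set of isomorphism classes of holomorphically flat, regular singular extensions of $R$ by $\mathcal V$. It is the canonical one: the class of an extension $\mathcal W$ corresponds to the class $\nu$ of $\widetilde\nu=a^{-1}(f-h)\in\widetilde{\mathcal V}$, for any $f\in\widetilde{\mathcal F}^{\geq k}\widetilde{\mathcal W}$ with $b(f)=1$ and any $h\in\widetilde{\mathcal W}$ with $\nabla_{q\,d/dq}h=0$ and $b(h)=1$. Conversely, if $\mathcal W$ corresponds to $\nu$ and $\widetilde\nu\in\widetilde{\mathcal V}$ is any lift of $\nu$, then there is $h\in\widetilde{\mathcal W}$ with $\nabla_{q\,d/dq}h=0$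 and $b(h)=1$ such that, in the parity of $R$, $\mathcal F^{\geq p}\mathcal W=a(\mathcal F^{\geq p}\mathcal V)+(\mathcal F^{\geq p}R)\cdot(a(\widetilde\nu)+h)$ for all $p$. -/

import Mathlib

open scoped LaurentSeries PowerSeries

/-- The formal punctured disk `R = ℂ((q))`. -/
abbrev PuncturedDisk : Type := ℂ⸨X⸩

/-- The formal disk `ℂ[[q]]`. -/
abbrev FormalDisk : Type := ℂ⟦X⟧

theorem laurent_derivative_coeff (f : PuncturedDisk) (n : ℤ) :
    (LaurentSeries.derivative ℂ f).coeff n = ((n + 1 : ℤ) : ℂ) * f.coeff (n + 1) := by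
  rw [LaurentSeries.derivative_apply, LaurentSeries.hasseDeriv_coeff]
  simp [zsmul_eq_mul]

/-- The Euler operator `q d/dq`, coefficient by coefficient; only used to prove the Leibniz rule. -/
theorem laurent_euler_coeff (f : PuncturedDisk) (n : ℤ) :
    ((HahnSeries.single (1 : ℤ) (1 : ℂ)) * LaurentSeries.derivative ℂ f).coeff n
      = (n : ℂ) * f.coeff n := by
  have h := HahnSeries.coeff_single_mul_add (r := (1 : ℂ)) (x := LaurentSeries.derivative ℂ f)
    (a := n - 1) (b := (1 : ℤ))
  rw [sub_add_cancel] at h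
  rw [h, laurent_derivative_coeff, sub_add_cancel, one_mul]

theorem laurent_euler_support (f : PuncturedDisk) :
    ((HahnSeries.single (1 : ℤ) (1 : ℂ)) * LaurentSeries.derivative ℂ f).support ⊆ f.support := by
  intro n hn hf
  apply hn
  rw [laurent_euler_coeff, hf, mul_zero]

theorem laurent_derivative_mul (f g : PuncturedDisk) :
    LaurentSeries.derivative ℂ (f * g)
      = LaurentSeries.derivative ℂ f * g + f * LaurentSeries.derivative ℂ g := by
  have hq : (HahnSeries.single (1 : ℤ) (1 : ℂ) : PuncturedDisk) ≠ 0 := by simp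
  apply mul_left_cancel₀ hq
  have e : (HahnSeries.single (1 : ℤ) (1 : ℂ) : PuncturedDisk)
      * (LaurentSeries.derivative ℂ f * g + f * LaurentSeries.derivative ℂ g)
      = (HahnSeries.single (1 : ℤ) (1 : ℂ) * LaurentSeries.derivative ℂ f) * g
        + f * (HahnSeries.single (1 : ℤ) (1 : ℂ) * LaurentSeries.derivative ℂ g) := by ring
  rw [e]
  ext n
  rw [laurent_euler_coeff, HahnSeries.coeff_add, HahnSeries.coeff_mul,
    HahnSeries.coeff_mul_left' f.isPWO_support (laurent_euler_support f),
    HahnSeries.coeff_mul_right' g.isPWO_support (laurent_euler_support g),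
    ← Finset.sum_add_distrib, Finset.mul_sum]
  refine Finset.sum_congr rfl fun ij hij => ?_
  rw [Finset.mem_antidiagonal] at hij
  rw [laurent_euler_coeff, laurent_euler_coeff, ← hij.2.2]
  push_cast
  ring

universe u v

noncomputable section

/-- A `ℤ/2`-graded variation of Hodge structures over `R = ℂ((q))`. The parity is `σ : ZMod 2`.
The Hodge filtration of the even part is indexed by integers and that of the odd part by
half-integers: `fil 0 p` is `F^{≥ p} V_ev` and `fil 1 p` is `F^{≥ p - 1/2} V_odd`, for `p : ℤ`.
The base is one-dimensional, so the connection is given by `∇_{d/dq}` and is flat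
(its `ℂ`-linearity follows from the Leibniz rule). -/
structure VHS where
  carrier : ZMod 2 → Type u
  [addCommGroup : ∀ σ, AddCommGroup (carrier σ)]
  [module : ∀ σ, Module PuncturedDisk (carrier σ)]
  [free : ∀ σ, Module.Free PuncturedDisk (carrier σ)]
  [finite : ∀ σ, Module.Finite PuncturedDisk (carrier σ)]
  /-- `∇_{d/dq}` -/
  nabla : ∀ σ, carrier σ →+ carrier σ
  leibniz : ∀ σ (r : PuncturedDisk) (x : carrier σ),
    nabla σ (r • x) = LaurentSeries.derivative ℂ r • x + r • nabla σ x
  /-- the decreasing Hodge filtration -/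
  fil : ∀ σ, ℤ → Submodule PuncturedDisk (carrier σ)
  fil_antitone : ∀ σ, Antitone (fil σ)
  griffiths : ∀ σ p, ∀ x ∈ fil σ p, nabla σ x ∈ fil σ (p - 1)

namespace VHS

attribute [instance] VHS.addCommGroup VHS.module VHS.free VHS.finite

/-- A polarisation. With `c = 0` on the even part and `c = 1` on the odd part, the filtration step
`fil σ p` has true index `p - c/2`; so the true indices of `p` and `r` have sum `p + r - c`,
and the true indices of `p` and `c - p` are opposite. -/
structure Polarisation (V : VHS.{u}) where
  form : ∀ σ, V.carrier σ →ₗ[PuncturedDisk] V.carrier σ →ₗ[PuncturedDisk] PuncturedDisk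
  n : ZMod 2
  symm : ∀ σ x y, form σ x y = (-1) ^ n.val * form σ y x
  vanish : ∀ σ (p r : ℤ), p + r > (σ.val : ℤ) → ∀ x ∈ V.fil σ p, ∀ y ∈ V.fil σ r, form σ x y = 0
  /-- the pairing induced on `Gr^p ⊗ Gr^{-p}` has no left kernel -/
  nondegenerate_left : ∀ σ (p : ℤ), ∀ x ∈ V.fil σ p,
    (∀ y ∈ V.fil σ ((σ.val : ℤ) - p), form σ x y = 0) → x ∈ V.fil σ (p + 1)
  /-- the pairing induced on `Gr^p ⊗ Gr^{-p}` has no right kernel -/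
  nondegenerate_right : ∀ σ (p : ℤ), ∀ y ∈ V.fil σ ((σ.val : ℤ) - p),
    (∀ x ∈ V.fil σ p, form σ x y = 0) → y ∈ V.fil σ ((σ.val : ℤ) - p + 1)

/-- Restriction of scalars from `ℂ((q))` to `ℂ[[q]]`. -/
instance diskModule (V : VHS.{u}) (σ : ZMod 2) : Module FormalDisk (V.carrier σ) :=
  Module.compHom (V.carrier σ) (algebraMap FormalDisk PuncturedDisk)

instance diskTower (V : VHS.{u}) (σ : ZMod 2) :
    IsScalarTower FormalDisk PuncturedDisk (V.carrier σ) where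
  smul_assoc r s x := by
    rw [Algebra.smul_def, mul_smul]
    rfl

/-- `∇_{q d/dq}` -/
def qnabla (V : VHS.{u}) (σ : ZMod 2) (x : V.carrier σ) : V.carrier σ :=
  (PowerSeries.X : FormalDisk) • V.nabla σ x

/-- `L` is a `ℂ[[q]]`-lattice stable under `∇_{q d/dq}`. -/
structure IsLogLattice (V : VHS.{u}) (σ : ZMod 2) (L : Submodule FormalDisk (V.carrier σ)) :
    Prop where
  fg : L.FG
  span : Submodule.span PuncturedDisk (L : Set (V.carrier σ)) = ⊤
  stable : ∀ x ∈ L, V.qnabla σ x ∈ L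

/-- `V` is regular singular. -/
def IsRegularSingular (V : VHS.{u}) : Prop :=
  ∀ σ, ∃ L : Submodule FormalDisk (V.carrier σ), V.IsLogLattice σ L

/-- `L` is a stable lattice such that the eigenvalues `μ` of the residue of the connection, that is
of the endomorphism of `L / q L` induced by `∇_{q d/dq}`, satisfy `0 ≤ Re μ < 1`. An eigenvector
is the class of an `x ∈ L` outside `q L` with `∇_{q d/dq} x - μ x ∈ q L`. -/
structure IsDeligneLattice (V : VHS.{u}) (σ : ZMod 2) (L : Submodule FormalDisk (V.carrier σ)) :
    Prop extends V.IsLogLattice σ L where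
  residue_eigenvalue : ∀ (μ : ℂ), ∀ x ∈ L,
    (¬ ∃ y ∈ L, x = (PowerSeries.X : FormalDisk) • y) →
    (∃ z ∈ L, V.qnabla σ x - (PowerSeries.C μ : FormalDisk) • x
      = (PowerSeries.X : FormalDisk) • z) →
    0 ≤ μ.re ∧ μ.re < 1

/-- The Deligne lattice. For regular singular `V` there is exactly one submodule satisfying
`IsDeligneLattice`, and the supremum is that submodule. -/
def deligneLattice (V : VHS.{u}) (σ : ZMod 2) : Submodule FormalDisk (V.carrier σ) :=
  sSup {L | V.IsDeligneLattice σ L}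

/-- The filtration on the Deligne lattice: the intersection with the Hodge filtration. -/
def latticeFil (V : VHS.{u}) (σ : ZMod 2) (p : ℤ) : Submodule FormalDisk (V.carrier σ) :=
  (V.fil σ p).restrictScalars FormalDisk ⊓ V.deligneLattice σ

/-- A morphism of VHS: even, `R`-linear, horizontal and compatible with the filtrations. -/
structure Hom (V : VHS.{u}) (W : VHS.{v}) where
  map : ∀ σ, V.carrier σ →ₗ[PuncturedDisk] W.carrier σ
  map_nabla : ∀ σ x, map σ (V.nabla σ x) = W.nabla σ (map σ x)
  map_fil : ∀ σ p, ∀ x ∈ V.fil σ p, map σ x ∈ W.fil σ p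

/-- `R` in parity `τ`, and `0` in the other parity. -/
def unitComponent (τ σ : ZMod 2) : Submodule PuncturedDisk PuncturedDisk :=
  if σ = τ then ⊤ else ⊥

theorem derivative_mem_unitComponent (τ σ : ZMod 2) (x : PuncturedDisk)
    (hx : x ∈ unitComponent τ σ) : LaurentSeries.derivative ℂ x ∈ unitComponent τ σ := by
  unfold unitComponent at *
  split_ifs at * with h
  · trivial
  · rw [Submodule.mem_bot] at *
    rw [hx, map_zero]

/-- The VHS `R`, placed in parity `τ`, with connection `d/dq` and with the filtration
`R` in steps `≤ k` and `0` in steps `> k`. -/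
def unit (τ : ZMod 2) (k : ℤ) : VHS.{0} where
  carrier σ := unitComponent τ σ
  nabla σ :=
    { toFun := fun x => ⟨LaurentSeries.derivative ℂ (x : PuncturedDisk),
        derivative_mem_unitComponent τ σ x x.2⟩
      map_zero' := by ext1; simp
      map_add' := fun x y => by ext1; simp }
  leibniz σ r x := by
    ext1
    exact laurent_derivative_mul r x
  fil σ p := if p ≤ k then ⊤ else ⊥
  fil_antitone σ p p' h := by
    dsimp only
    split_ifs with h1 h2
    · exact le_refl _
    · exact absurd (h.trans h1) h2
    · exact bot_le
    · exact le_refl _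
  griffiths σ p x hx := by
    by_cases h : p ≤ k
    · rw [if_pos (by omega)]
      trivial
    · rw [if_neg h, Submodule.mem_bot] at hx
      rw [hx, map_zero]
      exact Submodule.zero_mem _

/-- An extension `0 → V → W → R → 0` of VHS, `R` being `unit τ k`: a short exact sequence,
strict for the Hodge filtrations. -/
structure Extension (V : VHS.{u}) (τ : ZMod 2) (k : ℤ) where
  W : VHS.{u}
  a : Hom V W
  b : Hom W (unit τ k)
  injective : ∀ σ, Function.Injective (a.map σ)
  exact : ∀ σ, LinearMap.range (a.map σ) = LinearMap.ker (b.map σ)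
  surjective : ∀ σ, Function.Surjective (b.map σ)
  strict_left : ∀ σ p x, a.map σ x ∈ W.fil σ p → x ∈ V.fil σ p
  strict_right : ∀ σ p, ∀ y ∈ (unit τ k).fil σ p, ∃ x ∈ W.fil σ p, b.map σ x = y

namespace Extension

variable {V : VHS.{u}} {τ : ZMod 2} {k : ℤ}

/-- The value in `R = ℂ((q))` of `b` on the parity of `R`. -/
def value (E : Extension V τ k) (x : E.W.carrier τ) : PuncturedDisk :=
  Subtype.val (p := fun y => y ∈ unitComponent τ τ) (E.b.map τ x)

/-- A regular singular extension: `V` and `W` are regular singular and the exactness of the sequence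
of VHS holds for the filtered Deligne lattices, that is, each step of the filtration of the Deligne
lattice of `W` maps onto the corresponding step for `R` (the rest of the exactness is automatic;
surjectivity is not: an extension class may have a pole at `q = 0`). -/
structure IsRegularSingular (E : Extension V τ k) : Prop where
  left : V.IsRegularSingular
  middle : E.W.IsRegularSingular
  lattice_strict : ∀ σ p, ∀ y ∈ (unit τ k).latticeFil σ p,
    ∃ x ∈ E.W.latticeFil σ p, E.b.map σ x = y

/-- A lift of `1` to step `k` of the filtration of the Deligne lattice of `W`. -/
structure IsHodgeLift (E : Extension V τ k) (f : E.W.carrier τ) : Prop where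
  mem : f ∈ E.W.latticeFil τ k
  value_eq : E.value f = 1

/-- A flat lift of `1` to the Deligne lattice of `W`. -/
structure IsFlatLift (E : Extension V τ k) (h : E.W.carrier τ) : Prop where
  mem : h ∈ E.W.deligneLattice τ
  flat : E.W.qnabla τ h = 0
  value_eq : E.value h = 1

/-- The extension is holomorphically flat. -/
def IsHolomorphicallyFlat (E : Extension V τ k) : Prop :=
  ∃ h, E.IsFlatLift h

/-- An isomorphism of extensions: an isomorphism of the middle VHS which induces the identity
on `V` and on `R`. -/
structure Iso (E E' : Extension V τ k) where
  equiv : ∀ σ, E.W.carrier σ ≃ₗ[PuncturedDisk] E'.W.carrier σ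
  map_nabla : ∀ σ x, equiv σ (E.W.nabla σ x) = E'.W.nabla σ (equiv σ x)
  map_fil : ∀ σ p x, equiv σ x ∈ E'.W.fil σ p ↔ x ∈ E.W.fil σ p
  comp_a : ∀ σ x, equiv σ (E.a.map σ x) = E'.a.map σ x
  comp_b : ∀ σ x, E'.b.map σ (equiv σ x) = E.b.map σ x

end Extension

/-- The holomorphically flat, regular singular extensions of `R` by `V`. -/
def FlatExtension (V : VHS.{u}) (τ : ZMod 2) (k : ℤ) : Type (u + 1) :=
  {E : Extension V τ k // E.IsRegularSingular ∧ E.IsHolomorphicallyFlat}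

/-- Isomorphism of extensions is an equivalence relation. -/
instance flatExtensionSetoid (V : VHS.{u}) (τ : ZMod 2) (k : ℤ) :
    Setoid (FlatExtension V τ k) where
  r E E' := Nonempty (Extension.Iso E.1 E'.1)
  iseqv :=
    { refl := fun E => ⟨{ equiv := fun σ => LinearEquiv.refl _ _
                          map_nabla := fun σ x => rfl
                          map_fil := fun σ p x => Iff.rfl
                          comp_a := fun σ x => rfl
                          comp_b := fun σ x => rfl }⟩
      symm := by
        rintro E E' ⟨e⟩
        exact ⟨{ equiv := fun σ => (e.equiv σ).symm
                 map_nabla := fun σ x => by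
                  rw [LinearEquiv.symm_apply_eq, e.map_nabla, LinearEquiv.apply_symm_apply]
                 map_fil := fun σ p x => by
                  rw [← e.map_fil, LinearEquiv.apply_symm_apply]
                 comp_a := fun σ x => by
                  rw [LinearEquiv.symm_apply_eq, e.comp_a]
                 comp_b := fun σ x => by
                  rw [← e.comp_b, LinearEquiv.apply_symm_apply] }⟩
      trans := by
        rintro E E' E'' ⟨e⟩ ⟨e'⟩
        exact ⟨{ equiv := fun σ => (e.equiv σ).trans (e'.equiv σ)
                 map_nabla := fun σ x => by
                  simp only [LinearEquiv.trans_apply, e.map_nabla, e'.map_nabla]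
                 map_fil := fun σ p x => by
                  simp only [LinearEquiv.trans_apply, e.map_fil, e'.map_fil]
                 comp_a := fun σ x => by
                  simp only [LinearEquiv.trans_apply, e.comp_a, e'.comp_a]
                 comp_b := fun σ x => by
                  simp only [LinearEquiv.trans_apply, e.comp_b, e'.comp_b] }⟩ }

/-- Isomorphism classes of holomorphically flat, regular singular extensions of `R` by `V`. -/
def ExtensionClass (V : VHS.{u}) (τ : ZMod 2) (k : ℤ) : Type (u + 1) :=
  Quotient (flatExtensionSetoid V τ k)

/-- The isomorphism class of an extension. -/
def FlatExtension.toClass {V : VHS.{u}} {τ : ZMod 2} {k : ℤ} (E : FlatExtension V τ k) :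
    ExtensionClass V τ k :=
  Quotient.mk (flatExtensionSetoid V τ k) E

/-- The subgroup of the Deligne lattice spanned by step `k` of its filtration and by the flat
sections in it. -/
def jacobianRelations (V : VHS.{u}) (τ : ZMod 2) (k : ℤ) : AddSubgroup (V.deligneLattice τ) :=
  ((V.latticeFil τ k).toAddSubgroup ⊔ (V.nabla τ).ker ⊓ (V.deligneLattice τ).toAddSubgroup).comap
    (V.deligneLattice τ).subtype.toAddMonoidHom

/-- The generalised intermediate Jacobian. -/
abbrev Jacobian (V : VHS.{u}) (τ : ZMod 2) (k : ℤ) : Type u :=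
  V.deligneLattice τ ⧸ V.jacobianRelations τ k

/-- The class in the generalised intermediate Jacobian of an element of the Deligne lattice. -/
def jacobianMk (V : VHS.{u}) (τ : ZMod 2) (k : ℤ) (x : V.deligneLattice τ) : V.Jacobian τ k :=
  QuotientAddGroup.mk x

/-- Normal functions: the elements of the generalised intermediate Jacobian having a lift `x` to the
Deligne lattice such that `∇_{q d/dq} x` lies in step `k - 1` of the filtration. -/
def NormalFunction (V : VHS.{u}) (τ : ZMod 2) (k : ℤ) : Type u :=
  {ν : V.Jacobian τ k // ∃ x : V.deligneLattice τ,
    V.jacobianMk τ k x = ν ∧ V.qnabla τ x ∈ V.latticeFil τ (k - 1)}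

end VHS

end

/-! Both sides are compared through one relation, `IsDifference`: `f = a x + h` is a Hodge lift of
`1` for some flat lift `h`. In the parity of `R` such an `f` splits `W` as a filtered module into `a
V` and `R f`, and `∇ f = a (∇ x)` because `h` is flat. Hence `x` determines the extension up to
isomorphism (`IsDifference.nonempty_iso`), and Griffiths transversality for `f` is the condition
defining normal functions (`IsDifference.qnabla_mem`). Another choice of `f` moves `x` by an element
of step `k` of the lattice, another choice of `h` by a flat section, and all such moves occur; so
the differences in one extension form exactly one class of the Jacobian. Conversely, the flat sum `V
⊕ R` with its filtration twisted by `(x, 1)` realises any admissible `x` (`twistedExtension`).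

The analytic input is the theory of Deligne lattices. Existence comes from shearing: an arbitrary
stable lattice is enlarged to push all residue eigenvalues to the left, then they are raised by one,
repeatedly, until they lie in the strip. Uniqueness and functoriality hold because a horizontal map
with a pole would have a nonzero leading term intertwining residues whose spectra are disjoint
(`IsDeligneLattice.map_mem`). Pulling back along an injective horizontal map gives `a⁻¹(W̃) = Ṽ`, so
`f - h` does come from the lattice of `V`. -/

/-! ### Linear algebra: generalised eigenspaces and intertwiners. -/

section SpectralSplitting

variable {E : Type u} [AddCommGroup E] [Module ℂ E] {E' : Type v} [AddCommGroup E'] [Module ℂ E']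

/-- An intertwiner between endomorphisms without common eigenvalue vanishes. -/
theorem Module.End.eq_zero_of_intertwines [FiniteDimensional ℂ E] (T : Module.End ℂ E)
    (T' : Module.End ℂ E') (S : E →ₗ[ℂ] E') (h : ∀ x, S (T x) = T' (S x))
    (hd : ∀ μ, T.HasEigenvalue μ → ¬ T'.HasEigenvalue μ) : S = 0 := by
  rw [← LinearMap.ker_eq_top, ← top_le_iff, ← Module.End.iSup_maxGenEigenspace_eq_top T,
    iSup_le_iff]
  intro μ x hx
  rw [LinearMap.mem_ker]
  by_cases hμ : T.HasEigenvalue μ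
  · obtain ⟨n, hn⟩ := (Module.End.mem_maxGenEigenspace T μ x).1 hx
    -- `T' - μ` is injective, hence so are its powers, while `S` carries the nilpotency of `T - μ`
    -- at `x` to `T' - μ` at `S x`.
    have hinj : Function.Injective (T' - μ • (1 : Module.End ℂ E')) := by
      have := hd μ hμ
      rw [Module.End.hasEigenvalue_iff, not_not, Module.End.eigenspace_def] at this
      exact LinearMap.ker_eq_bot.1 this
    have hcomm : ∀ (m : ℕ) (y : E),
        S (((T - μ • (1 : Module.End ℂ E)) ^ m) y)
          = ((T' - μ • (1 : Module.End ℂ E')) ^ m) (S y) := by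
      intro m
      induction m with
      | zero => intro y; simp
      | succ m ih => intro y; rw [pow_succ, pow_succ, Module.End.mul_apply, Module.End.mul_apply,
                       ih]; simp [h]
    have h0 := hcomm n x
    rw [hn, map_zero] at h0
    have hinj' : Function.Injective ((T' - μ • (1 : Module.End ℂ E')) ^ n) := by
      rw [Module.End.coe_pow]
      exact hinj.iterate n
    exact hinj' (by rw [← h0, map_zero])
  -- The generalised eigenspace of a number that is not an eigenvalue is zero.
  · have : x = 0 := by
      obtain ⟨n, hn⟩ := (Module.End.mem_maxGenEigenspace T μ x).1 hx
      have hinj : Function.Injective (T - μ • (1 : Module.End ℂ E)) := by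
        rw [Module.End.hasEigenvalue_iff, not_not, Module.End.eigenspace_def] at hμ
        exact LinearMap.ker_eq_bot.1 hμ
      have hinj' : Function.Injective ((T - μ • (1 : Module.End ℂ E)) ^ n) := by
        rw [Module.End.coe_pow]
        exact hinj.iterate n
      exact hinj' (by rw [hn, map_zero])
    rw [this, map_zero]

/-- The sum of the generalised eigenspaces of `T` with eigenvalue in `s`. -/
noncomputable def Module.End.spectralPart (T : Module.End ℂ E) (s : Set ℂ) : Submodule ℂ E :=
  ⨆ μ ∈ s, T.maxGenEigenspace μ

theorem Module.End.mapsTo_spectralPart (T : Module.End ℂ E) (s : Set ℂ) :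
    T.spectralPart s ≤ (T.spectralPart s).comap T := by
  refine iSup₂_le fun μ hμ x hx => ?_
  exact (le_iSup₂ (f := fun ν (_ : ν ∈ s) => T.maxGenEigenspace ν) μ hμ)
    (Module.End.mapsTo_maxGenEigenspace_of_comm (Commute.refl T) μ hx)

theorem Module.End.mem_spectralPart_of_eigenvector (T : Module.End ℂ E) {s : Set ℂ} {μ : ℂ}
    (hμ : μ ∈ s) {x : E} (hx : T x - μ • x = 0) : x ∈ T.spectralPart s := by
  refine (le_iSup₂ (f := fun ν (_ : ν ∈ s) => T.maxGenEigenspace ν) μ hμ) ?_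
  exact (Module.End.mem_maxGenEigenspace T μ x).2 ⟨1, by simpa using hx⟩

theorem Module.End.disjoint_spectralPart_compl (T : Module.End ℂ E) (s : Set ℂ) :
    Disjoint (T.spectralPart s) (T.spectralPart sᶜ) :=
  (Module.End.independent_maxGenEigenspace T).disjoint_biSup_biSup disjoint_compl_right

theorem Module.End.spectralPart_sup_compl [FiniteDimensional ℂ E] (T : Module.End ℂ E)
    (s : Set ℂ) : T.spectralPart s ⊔ T.spectralPart sᶜ = ⊤ := by
  rw [← top_le_iff, ← Module.End.iSup_maxGenEigenspace_eq_top T, iSup_le_iff]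
  intro μ
  by_cases hμ : μ ∈ s
  · exact le_sup_of_le_left (le_iSup₂ (f := fun ν (_ : ν ∈ s) => T.maxGenEigenspace ν) μ hμ)
  · exact le_sup_of_le_right
      (le_iSup₂ (f := fun ν (_ : ν ∈ sᶜ) => T.maxGenEigenspace ν) μ hμ)

theorem Module.End.mem_of_eigenvector_spectralPart (T : Module.End ℂ E) (s : Set ℂ) {μ : ℂ}
    {x : E} (hx : x ∈ T.spectralPart s) (h0 : x ≠ 0) (h : T x - μ • x = 0) : μ ∈ s := by
  by_contra hμ
  exact h0 (Submodule.disjoint_def.1 (T.disjoint_spectralPart_compl s) x hx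
    (T.mem_spectralPart_of_eigenvector hμ h))

/-- The component `z` of `x` in the complementary part is a genuine eigenvector: `T z - μ z` lies in
both parts, so it vanishes. Thus the eigenvalues on the quotient by the `s`-part are eigenvalues of
`T` outside `s`. -/
theorem Module.End.eigenvalue_quotient_spectralPart [FiniteDimensional ℂ E] (T : Module.End ℂ E)
    (s : Set ℂ) {μ : ℂ} {x : E} (hx : x ∉ T.spectralPart s)
    (h : T x - μ • x ∈ T.spectralPart s) : μ ∉ s ∧ ∃ y, y ≠ 0 ∧ T y - μ • y = 0 := by
  obtain ⟨y, hy, z, hz, rfl⟩ := Submodule.mem_sup.1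
    ((T.spectralPart_sup_compl s).symm ▸ Submodule.mem_top : x ∈ T.spectralPart s ⊔ _)
  have hz0 : T z - μ • z = 0 := by
    refine Submodule.disjoint_def.1 (T.disjoint_spectralPart_compl s) _ ?_
      (Submodule.sub_mem _ (T.mapsTo_spectralPart _ hz) (Submodule.smul_mem _ _ hz))
    have : T z - μ • z = (T (y + z) - μ • (y + z)) - (T y - μ • y) := by
      rw [map_add, smul_add]; abel
    rw [this]
    exact Submodule.sub_mem _ h
      (Submodule.sub_mem _ (T.mapsTo_spectralPart _ hy) (Submodule.smul_mem _ _ hy))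
  refine ⟨fun hμ => hx (Submodule.add_mem _ hy (T.mem_spectralPart_of_eigenvector hμ hz0)), z, ?_,
    hz0⟩
  rintro rfl
  exact hx (by simpa using hy)

end SpectralSplitting

/-! ### Endomorphisms of subquotients `L / N`. -/

section Subquotient

variable {V : Type u} [AddCommGroup V] [Module ℂ V] {V' : Type v} [AddCommGroup V'] [Module ℂ V']

/-- The subquotient `L / N`. -/
abbrev Subquotient (L N : Submodule ℂ V) : Type u := L ⧸ N.submoduleOf L

/-- The endomorphism of `L / N` induced by `D`. -/
def Subquotient.endo {L N : Submodule ℂ V} (D : V →ₗ[ℂ] V) (hL : ∀ x ∈ L, D x ∈ L)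
    (hN : ∀ x ∈ N, D x ∈ N) : Module.End ℂ (Subquotient L N) :=
  (N.submoduleOf L).mapQ (N.submoduleOf L) (D.restrict hL) fun x hx => hN x hx

theorem Subquotient.mk_eq_zero {L N : Submodule ℂ V} (x : L) :
    (Submodule.Quotient.mk x : Subquotient L N) = 0 ↔ (x : V) ∈ N :=
  Submodule.Quotient.mk_eq_zero _

theorem Subquotient.endo_sub_smul {L N : Submodule ℂ V} (D : V →ₗ[ℂ] V)
    (hL : ∀ x ∈ L, D x ∈ L) (hN : ∀ x ∈ N, D x ∈ N) (μ : ℂ) (x : L) :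
    Subquotient.endo D hL hN (Submodule.Quotient.mk x) - μ • Submodule.Quotient.mk x
      = Submodule.Quotient.mk (D.restrict hL x - μ • x) := rfl

theorem Subquotient.finite {L N F : Submodule ℂ V} (hF : F.FG) (hFL : F ≤ L)
    (h : L ≤ F ⊔ N) : FiniteDimensional ℂ (Subquotient L N) := by
  have : FiniteDimensional ℂ F := Module.Finite.iff_fg.2 hF
  refine Module.Finite.of_surjective ((N.submoduleOf L).mkQ ∘ₗ Submodule.inclusion hFL) ?_
  intro z
  obtain ⟨⟨x, hx⟩, rfl⟩ := Submodule.Quotient.mk_surjective _ z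
  obtain ⟨y, hy, w, hw, rfl⟩ := Submodule.mem_sup.1 (h hx)
  refine ⟨⟨y, hy⟩, ?_⟩
  rw [LinearMap.comp_apply, Submodule.mkQ_apply, Submodule.Quotient.eq]
  change y - (y + w) ∈ N
  rw [sub_add_cancel_left]
  exact N.neg_mem hw

/-- Expresses eigenvalues through representatives in `V`, the form in which residue eigenvalues are
stated for lattices. -/
theorem Subquotient.hasEigenvalue_iff {L N : Submodule ℂ V} (D : V →ₗ[ℂ] V)
    (hL : ∀ x ∈ L, D x ∈ L) (hN : ∀ x ∈ N, D x ∈ N) (μ : ℂ) :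
    (Subquotient.endo D hL hN).HasEigenvalue μ ↔ ∃ x ∈ L, x ∉ N ∧ D x - μ • x ∈ N := by
  constructor
  · intro h
    obtain ⟨z, hz⟩ := h.exists_hasEigenvector
    obtain ⟨x, rfl⟩ := Submodule.Quotient.mk_surjective _ z
    refine ⟨x, x.2, fun hx => hz.2 ((Subquotient.mk_eq_zero x).2 hx), ?_⟩
    have := sub_eq_zero.2 hz.apply_eq_smul
    rw [Subquotient.endo_sub_smul, Subquotient.mk_eq_zero] at this
    exact this
  · rintro ⟨x, hx, hxN, h⟩
    refine Module.End.hasEigenvalue_of_hasEigenvector (x := Submodule.Quotient.mk ⟨x, hx⟩)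
      ⟨Module.End.mem_eigenspace_iff.2 (sub_eq_zero.1 ?_), ?_⟩
    · rw [Subquotient.endo_sub_smul, Subquotient.mk_eq_zero]
      exact h
    · rw [Ne, Subquotient.mk_eq_zero]
      exact hxN

theorem Subquotient.finite_eigenvalues {L N : Submodule ℂ V} (D : V →ₗ[ℂ] V)
    (hL : ∀ x ∈ L, D x ∈ L) (hN : ∀ x ∈ N, D x ∈ N) [FiniteDimensional ℂ (Subquotient L N)] :
    {μ : ℂ | ∃ x ∈ L, x ∉ N ∧ D x - μ • x ∈ N}.Finite := by
  simp_rw [← Subquotient.hasEigenvalue_iff D hL hN]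
  exact Module.End.finite_hasEigenvalue _

/-- Splitting a subquotient according to the eigenvalues of an endomorphism. -/
theorem Subquotient.exists_splitting {L N : Submodule ℂ V} (hNL : N ≤ L) (D : V →ₗ[ℂ] V)
    (hL : ∀ x ∈ L, D x ∈ L) (hN : ∀ x ∈ N, D x ∈ N) [FiniteDimensional ℂ (Subquotient L N)]
    (s : Set ℂ) :
    ∃ M : Submodule ℂ V, N ≤ M ∧ M ≤ L ∧ (∀ x ∈ M, D x ∈ M) ∧
      (∀ μ, ∀ x ∈ M, x ∉ N → D x - μ • x ∈ N → μ ∈ s) ∧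
      ∀ μ, ∀ x ∈ L, x ∉ M → D x - μ • x ∈ M → μ ∉ s ∧ ∃ y ∈ L, y ∉ N ∧ D y - μ • y ∈ N := by
  set T := Subquotient.endo D hL hN with hT
  -- The witness is the preimage in `L` of the `s`-part of `L / N`, viewed inside `V`.
  have key : ∀ x : L, (x : V) ∈ ((T.spectralPart s).comap (N.submoduleOf L).mkQ).map L.subtype ↔
      Submodule.Quotient.mk x ∈ T.spectralPart s := by
    intro x
    rw [Submodule.mem_map]
    constructor
    · rintro ⟨y, hy, hyx⟩
      rw [← Subtype.ext hyx]
      exact hy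
    · exact fun hx => ⟨x, hx, rfl⟩
  have hML : ((T.spectralPart s).comap (N.submoduleOf L).mkQ).map L.subtype ≤ L :=
    Submodule.map_subtype_le _ _
  refine ⟨((T.spectralPart s).comap (N.submoduleOf L).mkQ).map L.subtype, ?_, hML, ?_, ?_, ?_⟩
  · intro x hx
    rw [key ⟨x, hNL hx⟩, (Subquotient.mk_eq_zero _).2 hx]
    exact Submodule.zero_mem _
  · intro x hx
    have := (key ⟨x, hML hx⟩).1 hx
    exact (key ⟨D x, hL x (hML hx)⟩).2 (T.mapsTo_spectralPart s this)
  · intro μ x hx hxN h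
    refine T.mem_of_eigenvector_spectralPart s ((key ⟨x, hML hx⟩).1 hx)
      (fun h0 => hxN ((Subquotient.mk_eq_zero _).1 h0)) ?_
    rw [hT, Subquotient.endo_sub_smul, Subquotient.mk_eq_zero]
    exact h
  · intro μ x hx hxM h
    obtain ⟨hμ, y, hy0, hy⟩ := T.eigenvalue_quotient_spectralPart s (μ := μ)
      (fun h => hxM ((key ⟨x, hx⟩).2 h)) (by
        rw [hT, Subquotient.endo_sub_smul]
        exact (key (D.restrict hL ⟨x, hx⟩ - μ • (⟨x, hx⟩ : L))).1 h)
    refine ⟨hμ, (Subquotient.hasEigenvalue_iff D hL hN μ).1 ?_⟩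
    exact Module.End.hasEigenvalue_of_hasEigenvector
      ⟨Module.End.mem_eigenspace_iff.2 (sub_eq_zero.1 hy), hy0⟩

/-- The induced map `L / N → L' / N'` intertwines endomorphisms with disjoint spectra, so it is
zero. This is what lowers the pole order of a horizontal map between lattices. -/
theorem Subquotient.map_le_of_intertwines {L N : Submodule ℂ V} {L' N' : Submodule ℂ V'}
    (D : V →ₗ[ℂ] V) (D' : V' →ₗ[ℂ] V')
    (hL : ∀ x ∈ L, D x ∈ L) (hN : ∀ x ∈ N, D x ∈ N)
    (hL' : ∀ x ∈ L', D' x ∈ L') (hN' : ∀ x ∈ N', D' x ∈ N')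
    [FiniteDimensional ℂ (Subquotient L N)]
    (f : V →ₗ[ℂ] V') (hfL : ∀ x ∈ L, f x ∈ L') (hfN : ∀ x ∈ N, f x ∈ N')
    (hf : ∀ x, f (D x) = D' (f x))
    (hd : ∀ μ : ℂ, (∃ x ∈ L, x ∉ N ∧ D x - μ • x ∈ N) → ¬ ∃ x ∈ L', x ∉ N' ∧ D' x - μ • x ∈ N') :
    ∀ x ∈ L, f x ∈ N' := by
  intro x hx
  have h := Module.End.eq_zero_of_intertwines (Subquotient.endo D hL hN)
    (Subquotient.endo D' hL' hN')
    ((N.submoduleOf L).mapQ (N'.submoduleOf L') (f.restrict hfL) fun x hx => hfN x hx) (by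
      intro z
      obtain ⟨y, rfl⟩ := Submodule.Quotient.mk_surjective _ z
      exact congrArg Submodule.Quotient.mk (Subtype.ext (hf y))) (by
      intro μ
      rw [Subquotient.hasEigenvalue_iff, Subquotient.hasEigenvalue_iff]
      exact hd μ)
  exact (Subquotient.mk_eq_zero (⟨f x, hfL x hx⟩ : L')).1
    (LinearMap.congr_fun h (Submodule.Quotient.mk ⟨x, hx⟩))

end Subquotient

/-! ### The connection over the formal disk. -/

theorem laurent_derivative_coe (f : FormalDisk) :
    LaurentSeries.derivative ℂ (algebraMap FormalDisk PuncturedDisk f)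
      = algebraMap FormalDisk PuncturedDisk (PowerSeries.derivative ℂ f) := by
  ext n
  rw [laurent_derivative_coeff]
  change _ * ((f : PuncturedDisk)).coeff (n + 1)
    = ((PowerSeries.derivative ℂ f : FormalDisk) : PuncturedDisk).coeff n
  rw [PowerSeries.coeff_coe, PowerSeries.coeff_coe]
  rcases lt_or_ge n 0 with hn | hn
  · rw [if_pos hn]
    rcases lt_or_ge (n + 1) 0 with hn' | hn'
    · rw [if_pos hn', mul_zero]
    -- At `n = -1` the factor `n + 1` kills the constant term, so differentiation creates no pole.
    · have : n + 1 = 0 := by omega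
      rw [this]
      simp
  · rw [if_neg (by omega), if_neg (by omega), PowerSeries.coeff_derivative]
    have : (n + 1).natAbs = n.natAbs + 1 := by omega
    rw [this, mul_comm]
    congr 1
    obtain ⟨m, rfl⟩ := Int.eq_ofNat_of_zero_le hn
    simp

namespace VHS

variable {V : VHS.{u}} {W : VHS.{v}} {σ : ZMod 2}

theorem disk_smul (f : FormalDisk) (x : V.carrier σ) :
    f • x = algebraMap FormalDisk PuncturedDisk f • x := rfl

noncomputable instance complexModule (V : VHS.{u}) (σ : ZMod 2) : Module ℂ (V.carrier σ) :=
  Module.compHom (V.carrier σ) (PowerSeries.C : ℂ →+* FormalDisk)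

theorem complex_smul (c : ℂ) (x : V.carrier σ) : c • x = (PowerSeries.C c : FormalDisk) • x := rfl

instance complexTower (V : VHS.{u}) (σ : ZMod 2) :
    IsScalarTower ℂ FormalDisk (V.carrier σ) where
  smul_assoc c f x := by
    rw [PowerSeries.smul_eq_C_mul, mul_smul]
    rfl

theorem algebraMap_X_ne_zero : algebraMap FormalDisk PuncturedDisk PowerSeries.X ≠ 0 :=
  (map_ne_zero_iff _ (IsFractionRing.injective FormalDisk PuncturedDisk)).2 PowerSeries.X_ne_zero

theorem X_smul_injective :
    Function.Injective (fun x : V.carrier σ => (PowerSeries.X : FormalDisk) • x) :=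
  fun _ _ h => smul_right_injective _ algebraMap_X_ne_zero h

theorem X_pow_smul_injective (n : ℕ) :
    Function.Injective (fun x : V.carrier σ => (PowerSeries.X ^ n : FormalDisk) • x) := by
  intro x y h
  refine smul_right_injective (V.carrier σ)
    (pow_ne_zero n algebraMap_X_ne_zero) ?_
  simpa only [disk_smul, map_pow] using h

theorem exists_X_smul (x : V.carrier σ) : ∃ y : V.carrier σ, x = (PowerSeries.X : FormalDisk) • y :=
  ⟨(algebraMap FormalDisk PuncturedDisk PowerSeries.X)⁻¹ • x, by
    rw [disk_smul, smul_smul, mul_inv_cancel₀ algebraMap_X_ne_zero, one_smul]⟩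

theorem nabla_disk_smul (f : FormalDisk) (x : V.carrier σ) :
    V.nabla σ (f • x) = PowerSeries.derivative ℂ f • x + f • V.nabla σ x := by
  rw [disk_smul, V.leibniz, laurent_derivative_coe]
  rfl

theorem qnabla_add (x y : V.carrier σ) : V.qnabla σ (x + y) = V.qnabla σ x + V.qnabla σ y := by
  simp only [qnabla, map_add, smul_add]

theorem qnabla_disk_smul (f : FormalDisk) (x : V.carrier σ) :
    V.qnabla σ (f • x) = (PowerSeries.X * PowerSeries.derivative ℂ f) • x + f • V.qnabla σ x := by
  rw [qnabla, nabla_disk_smul, smul_add, smul_smul, qnabla, smul_comm]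

/-- Since `q d/dq` multiplies `q ^ n` by `n`, conjugation by `q ^ n` shifts the residue by `n`;
every shift of eigenvalues below comes from this. -/
theorem qnabla_X_pow_smul (n : ℕ) (x : V.carrier σ) :
    V.qnabla σ ((PowerSeries.X ^ n : FormalDisk) • x)
      = (PowerSeries.X ^ n : FormalDisk) • (V.qnabla σ x + (n : ℂ) • x) := by
  rw [qnabla_disk_smul, smul_add, add_comm]
  congr 1
  rw [complex_smul, smul_smul, Derivation.leibniz_pow]
  congr 1
  cases n with
  | zero => simp
  | succ n =>
    rw [PowerSeries.derivative_X, pow_succ]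
    simp
    ring

theorem qnabla_X_smul (x : V.carrier σ) :
    V.qnabla σ ((PowerSeries.X : FormalDisk) • x)
      = (PowerSeries.X : FormalDisk) • (V.qnabla σ x + x) := by
  simpa using V.qnabla_X_pow_smul 1 x

/-- `∇_{q d/dq}` as a `ℂ`-linear map. -/
noncomputable def qnablaLinear (V : VHS.{u}) (σ : ZMod 2) : V.carrier σ →ₗ[ℂ] V.carrier σ where
  toFun := V.qnabla σ
  map_add' := qnabla_add
  map_smul' c x := by
    rw [complex_smul, qnabla_disk_smul]
    simp [complex_smul]

theorem qnabla_eq_zero_iff (x : V.carrier σ) : V.qnabla σ x = 0 ↔ V.nabla σ x = 0 := by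
  constructor
  · intro h
    refine X_smul_injective (V := V) (σ := σ) ?_
    simpa [qnabla] using h
  · intro h
    rw [qnabla, h, smul_zero]

/-! ### Logarithmic lattices and their residues. -/

/-- The submodule `q L`. -/
noncomputable def qMul (L : Submodule FormalDisk (V.carrier σ)) : Submodule FormalDisk (V.carrier σ) :=
  L.map (LinearMap.lsmul FormalDisk (V.carrier σ) PowerSeries.X)

theorem mem_qMul {L : Submodule FormalDisk (V.carrier σ)} {x : V.carrier σ} :
    x ∈ qMul L ↔ ∃ y ∈ L, x = (PowerSeries.X : FormalDisk) • y := by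
  simp only [qMul, Submodule.mem_map, LinearMap.lsmul_apply, eq_comm]

theorem X_smul_mem_qMul {L : Submodule FormalDisk (V.carrier σ)} {x : V.carrier σ} :
    (PowerSeries.X : FormalDisk) • x ∈ qMul L ↔ x ∈ L := by
  rw [mem_qMul]
  constructor
  · rintro ⟨y, hy, h⟩
    rwa [X_smul_injective h]
  · exact fun h => ⟨x, h, rfl⟩

theorem qMul_le (L : Submodule FormalDisk (V.carrier σ)) : qMul L ≤ L := by
  intro x hx
  obtain ⟨y, hy, rfl⟩ := mem_qMul.1 hx
  exact L.smul_mem _ hy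

theorem qnabla_mem_qMul {L : Submodule FormalDisk (V.carrier σ)}
    (hL : ∀ x ∈ L, V.qnabla σ x ∈ L) : ∀ x ∈ qMul L, V.qnabla σ x ∈ qMul L := by
  intro x hx
  obtain ⟨y, hy, rfl⟩ := mem_qMul.1 hx
  rw [qnabla_X_smul, X_smul_mem_qMul]
  exact L.add_mem (hL y hy) hy

/-- `μ` is an eigenvalue of the residue of `∇_{q d/dq}` on `L / q L`. -/
def IsResidueEigenvalue (L : Submodule FormalDisk (V.carrier σ)) (μ : ℂ) : Prop :=
  ∃ x ∈ L, x ∉ qMul L ∧ V.qnabla σ x - μ • x ∈ qMul L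

theorem isDeligneLattice_iff {L : Submodule FormalDisk (V.carrier σ)} :
    V.IsDeligneLattice σ L ↔
      V.IsLogLattice σ L ∧ ∀ μ, IsResidueEigenvalue L μ → 0 ≤ μ.re ∧ μ.re < 1 := by
  constructor
  · rintro ⟨h, h'⟩
    refine ⟨h, ?_⟩
    rintro μ ⟨x, hx, hxq, hμ⟩
    exact h' μ x hx (fun h => hxq (mem_qMul.2 h)) (mem_qMul.1 hμ)
  · rintro ⟨h, h'⟩
    exact ⟨h, fun μ x hx hxq hμ =>
      h' μ ⟨x, hx, fun h => hxq (mem_qMul.1 h), mem_qMul.2 hμ⟩⟩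

/-- Writing `f = q g + f(0)` shows that generators over `ℂ[[q]]` span `L / q L` over `ℂ`. -/
theorem finiteDimensional_residue {L : Submodule FormalDisk (V.carrier σ)} (hL : L.FG) :
    FiniteDimensional ℂ (Subquotient (L.restrictScalars ℂ) ((qMul L).restrictScalars ℂ)) := by
  obtain ⟨s, rfl⟩ := hL
  set L := Submodule.span FormalDisk (s : Set (V.carrier σ))
  have hF : Submodule.span ℂ (s : Set (V.carrier σ)) ≤ L.restrictScalars ℂ :=
    Submodule.span_le.2 Submodule.subset_span
  refine Subquotient.finite (F := Submodule.span ℂ (s : Set (V.carrier σ))) ⟨s, rfl⟩ hF ?_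
  intro x hx
  rw [Submodule.restrictScalars_mem] at hx
  induction hx using Submodule.span_induction with
  | mem x hx => exact Submodule.mem_sup_left (Submodule.subset_span hx)
  | zero => exact Submodule.zero_mem _
  | add x y _ _ hx hy => exact Submodule.add_mem _ hx hy
  | smul f x hxL hx =>
    rw [PowerSeries.eq_X_mul_shift_add_const f, add_smul, mul_smul]
    refine Submodule.add_mem _ (Submodule.mem_sup_right ?_) (Submodule.smul_mem _ _ hx)
    exact X_smul_mem_qMul.2 (L.smul_mem _ hxL)

theorem IsLogLattice.finite_residueEigenvalue {L : Submodule FormalDisk (V.carrier σ)}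
    (hL : V.IsLogLattice σ L) : {μ | IsResidueEigenvalue L μ}.Finite := by
  have := finiteDimensional_residue hL.fg
  exact Subquotient.finite_eigenvalues (L := L.restrictScalars ℂ)
    (N := (qMul L).restrictScalars ℂ) (V.qnablaLinear σ) hL.stable (qnabla_mem_qMul hL.stable)

theorem exists_X_pow_mul (r : PuncturedDisk) :
    ∃ (n : ℕ) (f : FormalDisk), algebraMap FormalDisk PuncturedDisk (PowerSeries.X ^ n) * r
      = algebraMap FormalDisk PuncturedDisk f := by
  obtain ⟨⟨f, ⟨_, n, rfl⟩⟩, h⟩ := IsLocalization.surj (Submonoid.powers (PowerSeries.X : FormalDisk)) r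
  exact ⟨n, f, by rw [mul_comm]; exact h⟩

theorem exists_X_pow_smul_mem {L : Submodule FormalDisk (V.carrier σ)}
    (hL : Submodule.span PuncturedDisk (L : Set (V.carrier σ)) = ⊤) (x : V.carrier σ) :
    ∃ n : ℕ, (PowerSeries.X ^ n : FormalDisk) • x ∈ L := by
  have hx : x ∈ Submodule.span PuncturedDisk (L : Set (V.carrier σ)) := hL ▸ Submodule.mem_top
  induction hx using Submodule.span_induction with
  | mem x hx => exact ⟨0, by simpa using hx⟩
  | zero => exact ⟨0, by simp⟩
  | add x y _ _ hx hy =>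
    obtain ⟨n, hn⟩ := hx
    obtain ⟨m, hm⟩ := hy
    refine ⟨n + m, ?_⟩
    rw [smul_add]
    refine L.add_mem ?_ ?_
    · rw [add_comm, pow_add, mul_smul]; exact L.smul_mem _ hn
    · rw [pow_add, mul_smul]; exact L.smul_mem _ hm
  | smul r x _ hx =>
    obtain ⟨n, hn⟩ := hx
    obtain ⟨m, f, hf⟩ := exists_X_pow_mul r
    refine ⟨m + n, ?_⟩
    have : (PowerSeries.X ^ (m + n) : FormalDisk) • r • x
        = f • (PowerSeries.X ^ n : FormalDisk) • x := by
      simp only [disk_smul]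
      rw [pow_add, map_mul, smul_smul, smul_smul, ← hf]
      congr 1
      ring
    rw [this]
    exact L.smul_mem _ hn

theorem span_eq_top_of_X_pow_smul_mem {L : Submodule FormalDisk (V.carrier σ)}
    (h : ∀ x : V.carrier σ, ∃ n : ℕ, (PowerSeries.X ^ n : FormalDisk) • x ∈ L) :
    Submodule.span PuncturedDisk (L : Set (V.carrier σ)) = ⊤ := by
  rw [eq_top_iff]
  intro x _
  obtain ⟨n, hn⟩ := h x
  have := Submodule.smul_mem _ ((algebraMap FormalDisk PuncturedDisk PowerSeries.X ^ n)⁻¹)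
    (Submodule.subset_span (R := PuncturedDisk) hn)
  rwa [disk_smul, map_pow, smul_smul, inv_mul_cancel₀ (pow_ne_zero n algebraMap_X_ne_zero),
    one_smul] at this

theorem fg_of_le {L M : Submodule FormalDisk (V.carrier σ)} (hM : M.FG) (h : L ≤ M) : L.FG := by
  have : Module.Finite FormalDisk M := Module.Finite.iff_fg.2 hM
  have := (IsNoetherian.noetherian (L.submoduleOf M)).map M.subtype
  rwa [Submodule.submoduleOf, Submodule.map_comap_subtype, inf_eq_right.2 h] at this

theorem fg_comap {L : Submodule FormalDisk (W.carrier σ)} (hL : L.FG)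
    (f : V.carrier σ →ₗ[FormalDisk] W.carrier σ) (hf : Function.Injective f) :
    (L.comap f).FG :=
  Submodule.fg_of_fg_map_injective f hf (fg_of_le hL (Submodule.map_comap_le _ _))

/-- The lattice `q⁻ⁿ L`. -/
theorem IsLogLattice.comap_X_pow {L : Submodule FormalDisk (V.carrier σ)}
    (hL : V.IsLogLattice σ L) (n : ℕ) :
    V.IsLogLattice σ (L.comap (LinearMap.lsmul FormalDisk (V.carrier σ) (PowerSeries.X ^ n))) where
  fg := fg_comap hL.fg _ (X_pow_smul_injective n)
  span := by
    refine span_eq_top_of_X_pow_smul_mem fun x => ?_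
    obtain ⟨m, hm⟩ := exists_X_pow_smul_mem hL.span x
    exact ⟨m, L.smul_mem _ hm⟩
  stable x hx := by
    rw [Submodule.mem_comap, LinearMap.lsmul_apply] at *
    have := L.sub_mem (hL.stable _ hx) (L.smul_mem (PowerSeries.C (n : ℂ)) hx)
    rw [qnabla_X_pow_smul, smul_add, complex_smul, smul_comm (PowerSeries.C (n : ℂ)),
      add_sub_cancel_right] at this
    exact this

/-- Multiplication by `q ^ n` identifies `q⁻ⁿ L` with `L` and adds `n` to the residue. -/
theorem isResidueEigenvalue_of_comap_X_pow {L : Submodule FormalDisk (V.carrier σ)} {n : ℕ} {μ : ℂ}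
    (h : IsResidueEigenvalue
      (L.comap (LinearMap.lsmul FormalDisk (V.carrier σ) (PowerSeries.X ^ n))) μ) :
    IsResidueEigenvalue L (μ + n) := by
  obtain ⟨x, hx, hxq, hμ⟩ := h
  have key : ∀ y : V.carrier σ, (PowerSeries.X ^ n : FormalDisk) • y ∈ qMul L →
      y ∈ qMul (L.comap (LinearMap.lsmul FormalDisk (V.carrier σ) (PowerSeries.X ^ n))) := by
    intro y hy
    obtain ⟨z, rfl⟩ := exists_X_smul y
    rw [smul_comm, X_smul_mem_qMul] at hy
    rw [X_smul_mem_qMul]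
    exact hy
  refine ⟨(PowerSeries.X ^ n : FormalDisk) • x, hx, fun h => hxq (key _ h), ?_⟩
  obtain ⟨y, hy, hxy⟩ := mem_qMul.1 hμ
  rw [qnabla_X_pow_smul, smul_comm (μ + (n : ℂ)), ← smul_sub, add_smul, add_sub_add_right_eq_sub,
    hxy, smul_comm, X_smul_mem_qMul]
  exact hy

/-! ### Existence of the Deligne lattice by shearing. -/

/-- Take `q L ⊆ L' ⊆ L` with `L' / q L` the part of `L / q L` where `0 ≤ Re μ`. The residue on `L' /
q L'` has quotient `L' / q L`, whose eigenvalues are kept, and sub `q L / q L'`, which is `L / L'`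
with its eigenvalues (those with `Re μ < 0`) raised by one. -/
theorem IsLogLattice.exists_raise {L : Submodule FormalDisk (V.carrier σ)}
    (hL : V.IsLogLattice σ L) (n : ℕ)
    (h : ∀ μ, IsResidueEigenvalue L μ → -((n : ℝ) + 1) ≤ μ.re ∧ μ.re < 1) :
    ∃ L' : Submodule FormalDisk (V.carrier σ), V.IsLogLattice σ L' ∧
      ∀ μ, IsResidueEigenvalue L' μ → -(n : ℝ) ≤ μ.re ∧ μ.re < 1 := by
  have := finiteDimensional_residue hL.fg
  obtain ⟨M, hNM, hML, hM, h1, h2⟩ := Subquotient.exists_splitting (L := L.restrictScalars ℂ)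
    (N := (qMul L).restrictScalars ℂ) (qMul_le L) (V.qnablaLinear σ) hL.stable
    (qnabla_mem_qMul hL.stable) {μ : ℂ | 0 ≤ μ.re}
  -- The complex subspace `M` is stable under `ℂ[[q]]` because it contains `q L`: only the constant
  -- term of `f` acts modulo `q L`.
  let L' : Submodule FormalDisk (V.carrier σ) :=
    { M with
      smul_mem' := fun f x hx => by
        rw [PowerSeries.eq_X_mul_shift_add_const f, add_smul, mul_smul]
        exact M.add_mem (hNM (X_smul_mem_qMul.2 (L.smul_mem _ (hML hx)))) (M.smul_mem _ hx) }
  have hL'M : ∀ x, x ∈ L' ↔ x ∈ M := fun x => Iff.rfl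
  refine ⟨L', ⟨fg_of_le hL.fg hML, ?_, hM⟩, ?_⟩
  · refine span_eq_top_of_X_pow_smul_mem fun x => ?_
    obtain ⟨m, hm⟩ := exists_X_pow_smul_mem hL.span x
    refine ⟨m + 1, ?_⟩
    rw [pow_succ', mul_smul]
    exact hNM (X_smul_mem_qMul.2 hm)
  · rintro μ ⟨x, hx, hxq, hμ⟩
    have hq : qMul L' ≤ qMul L := Submodule.map_mono hML
    -- Either the eigenvector lies in `q L / q L'`, and dividing by `q` lowers the eigenvalue by
    -- one, or it survives in `L' / q L`.
    by_cases hxL : x ∈ qMul L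
    · obtain ⟨y, hy, rfl⟩ := mem_qMul.1 hxL
      rw [X_smul_mem_qMul] at hxq
      have e : V.qnabla σ ((PowerSeries.X : FormalDisk) • y)
          - μ • (PowerSeries.X : FormalDisk) • y
          = (PowerSeries.X : FormalDisk) • (V.qnabla σ y - (μ - 1) • y) := by
        rw [qnabla_X_smul, smul_comm μ, ← smul_sub, sub_smul, one_smul]
        congr 1
        abel
      rw [e, X_smul_mem_qMul] at hμ
      obtain ⟨hneg, hev⟩ := h2 (μ - 1) y hy hxq hμ
      have hb := (h _ hev).1
      simp only [Set.mem_ofPred_eq, not_le, Complex.sub_re, Complex.one_re] at hneg hb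
      constructor <;> linarith
    · have hpos : 0 ≤ μ.re := h1 μ x hx hxL (hq hμ)
      have hlt := (h μ ⟨x, hML hx, hxL, hq hμ⟩).2
      have : (0 : ℝ) ≤ n := Nat.cast_nonneg n
      constructor <;> linarith

theorem IsLogLattice.exists_isDeligneLattice {L : Submodule FormalDisk (V.carrier σ)}
    (hL : V.IsLogLattice σ L) : ∃ L', V.IsDeligneLattice σ L' := by
  have step : ∀ (n : ℕ) (L : Submodule FormalDisk (V.carrier σ)), V.IsLogLattice σ L →
      (∀ μ, IsResidueEigenvalue L μ → -(n : ℝ) ≤ μ.re ∧ μ.re < 1) →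
      ∃ L', V.IsDeligneLattice σ L' := by
    intro n
    induction n with
    | zero => exact fun L hL h => ⟨L, isDeligneLattice_iff.2 ⟨hL, by simpa using h⟩⟩
    | succ n ih =>
      intro L hL h
      obtain ⟨L', hL', h'⟩ := hL.exists_raise n (by simpa using h)
      exact ih L' hL' h'
  obtain ⟨C, hC⟩ := (hL.finite_residueEigenvalue.image fun μ => |μ.re|).bddAbove
  obtain ⟨N, hN⟩ := exists_nat_gt C
  have hb : ∀ μ, IsResidueEigenvalue L μ → |μ.re| < N := fun μ hμ =>
    (hC (Set.mem_image_of_mem (fun μ : ℂ => |μ.re|) hμ)).trans_lt hN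
  -- With `|Re| < N` on `L`, the eigenvalues on `q⁻ᴺ L` have real part between `-2N` and `0`, so
  -- `2N` raisings suffice.
  refine step (N + N) _ (hL.comap_X_pow N) fun μ hμ => ?_
  have := abs_lt.1 (hb _ (isResidueEigenvalue_of_comap_X_pow hμ))
  simp only [Complex.add_re, Complex.natCast_re] at this
  push_cast
  constructor <;> linarith

/-! ### Functoriality and uniqueness of Deligne lattices. -/

theorem map_disk_smul (φ : V.carrier σ →ₗ[PuncturedDisk] W.carrier σ) (f : FormalDisk)
    (x : V.carrier σ) : φ (f • x) = f • φ x :=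
  φ.map_smul _ x

theorem map_qnabla {φ : V.carrier σ →ₗ[PuncturedDisk] W.carrier σ}
    (hφ : ∀ x, φ (V.nabla σ x) = W.nabla σ (φ x)) (x : V.carrier σ) :
    φ (V.qnabla σ x) = W.qnabla σ (φ x) := by
  rw [qnabla, map_disk_smul, hφ, qnabla]

open scoped Classical in
/-- Horizontal maps preserve Deligne lattices. -/
theorem IsDeligneLattice.map_mem {L : Submodule FormalDisk (V.carrier σ)}
    {M : Submodule FormalDisk (W.carrier σ)} (hL : V.IsDeligneLattice σ L)
    (hM : W.IsDeligneLattice σ M) (φ : V.carrier σ →ₗ[PuncturedDisk] W.carrier σ)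
    (hφ : ∀ x, φ (V.nabla σ x) = W.nabla σ (φ x)) : ∀ x ∈ L, φ x ∈ M := by
  have := finiteDimensional_residue hL.fg
  have step : ∀ n : ℕ, (∀ x ∈ L, (PowerSeries.X ^ n : FormalDisk) • φ x ∈ M) →
      ∀ x ∈ L, φ x ∈ M := by
    intro n
    induction n with
    | zero => intro h x hx; simpa using h x hx
    | succ n ih =>
      intro h
      refine ih fun x hx => ?_
      -- With a pole of order at most `n + 1`, the map `q ^ (n + 1) φ` intertwines the residue of
      -- `L` plus `n + 1`, with real parts in `[n + 1, n + 2)`, and the residue of `M`, with real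
      -- parts in `[0, 1)`. It is therefore zero modulo `q M`, and one power of `q` can be removed.
      let ψ : V.carrier σ →ₗ[ℂ] W.carrier σ :=
        { toFun := fun x => (PowerSeries.X ^ (n + 1) : FormalDisk) • φ x
          map_add' := fun x y => by rw [map_add, smul_add]
          map_smul' := fun c x => by
            rw [complex_smul, map_disk_smul, smul_comm]
            rfl }
      have hadd : ∀ (K : Submodule FormalDisk (V.carrier σ)), (∀ x ∈ K, V.qnabla σ x ∈ K) →
          ∀ x ∈ K.restrictScalars ℂ,
            (V.qnablaLinear σ + ((n + 1 : ℕ) : ℂ) • LinearMap.id : V.carrier σ →ₗ[ℂ] V.carrier σ) x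
            ∈ K.restrictScalars ℂ := by
        intro K hK x hx
        exact (K.restrictScalars ℂ).add_mem (hK x hx) ((K.restrictScalars ℂ).smul_mem _ hx)
      have key := Subquotient.map_le_of_intertwines (L := L.restrictScalars ℂ)
        (N := (qMul L).restrictScalars ℂ) (L' := M.restrictScalars ℂ)
        (N' := (qMul M).restrictScalars ℂ)
        (V.qnablaLinear σ + ((n + 1 : ℕ) : ℂ) • LinearMap.id) (W.qnablaLinear σ)
        (hadd _ hL.stable) (hadd _ (qnabla_mem_qMul hL.stable)) hM.stable
        (qnabla_mem_qMul hM.stable) ψ h ?_ ?_ ?_ x hx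
      · rw [Submodule.restrictScalars_mem] at key
        change (PowerSeries.X ^ (n + 1) : FormalDisk) • φ x ∈ _ at key
        rwa [pow_succ', mul_smul, X_smul_mem_qMul] at key
      · intro x hx
        obtain ⟨y, hy, rfl⟩ := mem_qMul.1 hx
        change (PowerSeries.X ^ (n + 1) : FormalDisk) • φ _ ∈ qMul M
        rw [map_disk_smul, smul_comm, X_smul_mem_qMul]
        exact h y hy
      · intro x
        change (PowerSeries.X ^ (n + 1) : FormalDisk) • φ (V.qnabla σ x + ((n + 1 : ℕ) : ℂ) • x)
          = W.qnabla σ ((PowerSeries.X ^ (n + 1) : FormalDisk) • φ x)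
        rw [qnabla_X_pow_smul, map_add, map_qnabla hφ, complex_smul, map_disk_smul]
        rfl
      · rintro μ ⟨x, hx, hxq, hμ⟩ hμ'
        have h1 := (isDeligneLattice_iff.1 hL).2 (μ - ((n + 1 : ℕ) : ℂ)) ⟨x, hx, hxq, by
          have e : V.qnabla σ x - (μ - ((n + 1 : ℕ) : ℂ)) • x
            = V.qnabla σ x + ((n + 1 : ℕ) : ℂ) • x - μ • x := by rw [sub_smul]; abel
          rw [e]
          exact hμ⟩
        have h2 := (isDeligneLattice_iff.1 hM).2 μ hμ'
        simp only [Complex.sub_re, Complex.natCast_re] at h1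
        push_cast at h1
        have : (0 : ℝ) ≤ n := Nat.cast_nonneg n
        linarith [h1.1, h2.2]
  obtain ⟨s, hs⟩ := hL.fg
  choose N hN using fun x : V.carrier σ => exists_X_pow_smul_mem hM.span (φ x)
  -- A bound for the pole order valid on all generators at once.
  refine step (∑ x ∈ s, N x) fun x hx => ?_
  rw [← hs] at hx
  induction hx using Submodule.span_induction with
  | mem x hx =>
    rw [← Finset.sum_erase_add s N hx, pow_add, mul_smul]
    exact M.smul_mem _ (hN x)
  | zero => simp
  | add x y _ _ hx hy => rw [map_add, smul_add]; exact M.add_mem hx hy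
  | smul f x _ hx => rw [map_disk_smul, smul_comm]; exact M.smul_mem _ hx

theorem IsDeligneLattice.unique {L M : Submodule FormalDisk (V.carrier σ)}
    (hL : V.IsDeligneLattice σ L) (hM : V.IsDeligneLattice σ M) : L = M :=
  le_antisymm (hL.map_mem hM LinearMap.id fun _ => rfl) (hM.map_mem hL LinearMap.id fun _ => rfl)

theorem IsDeligneLattice.eq_deligneLattice {L : Submodule FormalDisk (V.carrier σ)}
    (hL : V.IsDeligneLattice σ L) : V.deligneLattice σ = L := by
  have : {L | V.IsDeligneLattice σ L} = {L} :=
    Set.ext fun M => ⟨fun hM => hM.unique hL, fun hM => Set.mem_singleton_iff.1 hM ▸ hL⟩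
  rw [deligneLattice, this, sSup_singleton]

theorem IsRegularSingular.isDeligneLattice (hV : V.IsRegularSingular) (σ : ZMod 2) :
    V.IsDeligneLattice σ (V.deligneLattice σ) := by
  obtain ⟨L, hL⟩ := hV σ
  obtain ⟨L', hL'⟩ := hL.exists_isDeligneLattice
  rwa [hL'.eq_deligneLattice]

theorem IsRegularSingular.map_mem_deligneLattice (hV : V.IsRegularSingular)
    (hW : W.IsRegularSingular) (φ : V.carrier σ →ₗ[PuncturedDisk] W.carrier σ)
    (hφ : ∀ x, φ (V.nabla σ x) = W.nabla σ (φ x)) {x : V.carrier σ}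
    (hx : x ∈ V.deligneLattice σ) : φ x ∈ W.deligneLattice σ :=
  (hV.isDeligneLattice σ).map_mem (hW.isDeligneLattice σ) φ hφ x hx

/-- As `q` is invertible on `V`, an element of the preimage that maps into `q M` lies in `q` times
the preimage. Hence residue eigenvectors map to residue eigenvectors of `M`. -/
theorem IsDeligneLattice.comap {M : Submodule FormalDisk (W.carrier σ)}
    (hM : W.IsDeligneLattice σ M) (φ : V.carrier σ →ₗ[PuncturedDisk] W.carrier σ)
    (hφ : ∀ x, φ (V.nabla σ x) = W.nabla σ (φ x)) (hi : Function.Injective φ) :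
    V.IsDeligneLattice σ (M.comap (φ.restrictScalars FormalDisk)) := by
  have hmem : ∀ x, x ∈ M.comap (φ.restrictScalars FormalDisk) ↔ φ x ∈ M := fun x => Iff.rfl
  have hq : ∀ x, x ∈ qMul (M.comap (φ.restrictScalars FormalDisk)) ↔ φ x ∈ qMul M := by
    intro x
    obtain ⟨y, rfl⟩ := exists_X_smul x
    rw [X_smul_mem_qMul, map_disk_smul, X_smul_mem_qMul, hmem]
  refine isDeligneLattice_iff.2 ⟨⟨fg_comap hM.fg _ hi, ?_, ?_⟩, ?_⟩
  · refine span_eq_top_of_X_pow_smul_mem fun x => ?_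
    obtain ⟨n, hn⟩ := exists_X_pow_smul_mem hM.span (φ x)
    exact ⟨n, by rwa [hmem, map_disk_smul]⟩
  · intro x hx
    rw [hmem, map_qnabla hφ]
    exact hM.stable _ hx
  · rintro μ ⟨x, hx, hxq, hμ⟩
    refine (isDeligneLattice_iff.1 hM).2 μ ⟨φ x, hx, fun h => hxq ((hq x).2 h), ?_⟩
    rw [hq, map_sub, map_qnabla hφ, complex_smul, map_disk_smul] at hμ
    exact hμ

theorem IsRegularSingular.mem_deligneLattice_of_injective
    (hW : W.IsRegularSingular) (φ : V.carrier σ →ₗ[PuncturedDisk] W.carrier σ)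
    (hφ : ∀ x, φ (V.nabla σ x) = W.nabla σ (φ x)) (hi : Function.Injective φ)
    {x : V.carrier σ} : x ∈ V.deligneLattice σ ↔ φ x ∈ W.deligneLattice σ := by
  rw [((hW.isDeligneLattice σ).comap φ hφ hi).eq_deligneLattice]
  rfl

end VHS

/-! ### The Deligne lattice of `R`. -/

namespace VHS

section Unit

variable {τ σ : ZMod 2} {k : ℤ}

/-- The underlying Laurent series of an element of `R`. -/
noncomputable def unitVal (τ : ZMod 2) (k : ℤ) (σ : ZMod 2) :
    (unit τ k).carrier σ →ₗ[PuncturedDisk] PuncturedDisk :=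
  (unitComponent τ σ).subtype

theorem unitVal_injective : Function.Injective (unitVal τ k σ) :=
  (unitComponent τ σ).subtype_injective

theorem unitVal_nabla (y : (unit τ k).carrier σ) :
    unitVal τ k σ ((unit τ k).nabla σ y) = LaurentSeries.derivative ℂ (unitVal τ k σ y) := rfl

theorem unit_subsingleton (h : σ ≠ τ) : Subsingleton ((unit τ k).carrier σ) := by
  have h0 : ∀ y : (unit τ k).carrier σ, unitVal τ k σ y = 0 := by
    rintro ⟨y, hy⟩
    have hy' := hy
    rw [unitComponent, if_neg h] at hy'
    exact hy'
  exact ⟨fun x y => unitVal_injective ((h0 x).trans (h0 y).symm)⟩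

theorem mem_unit_fil {p : ℤ} (y : (unit τ k).carrier σ) :
    y ∈ (unit τ k).fil σ p ↔ p ≤ k ∨ unitVal τ k σ y = 0 := by
  have e : (unit τ k).fil σ p = if p ≤ k then ⊤ else ⊥ := rfl
  rw [e, map_eq_zero_iff _ unitVal_injective]
  split_ifs with h <;> simp [h]

/-- The element `1` of `R`. -/
noncomputable def unitOne (τ : ZMod 2) (k : ℤ) : (unit τ k).carrier τ :=
  ⟨1, by simp [unitComponent]⟩

theorem unitVal_one : unitVal τ k τ (unitOne τ k) = 1 := rfl

theorem unitVal_disk_smul_one (f : FormalDisk) :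
    unitVal τ k τ (f • unitOne τ k) = algebraMap FormalDisk PuncturedDisk f := by
  rw [disk_smul, map_smul, unitVal_one, smul_eq_mul, mul_one]

theorem unitVal_smul_one (y : (unit τ k).carrier τ) : unitVal τ k τ y • unitOne τ k = y :=
  unitVal_injective (by rw [map_smul, unitVal_one, smul_eq_mul, mul_one])

theorem qnabla_disk_smul_unitOne (f : FormalDisk) :
    (unit τ k).qnabla τ (f • unitOne τ k)
      = (PowerSeries.X * PowerSeries.derivative ℂ f) • unitOne τ k := by
  have h : (unit τ k).qnabla τ (unitOne τ k) = 0 := by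
    rw [qnabla_eq_zero_iff]
    refine unitVal_injective ?_
    rw [unitVal_nabla, unitVal_one, map_zero]
    have := laurent_derivative_coe 1
    simpa using this
  rw [qnabla_disk_smul, h, smul_zero, add_zero]

theorem isDeligneLattice_unit (τ : ZMod 2) (k : ℤ) :
    (unit τ k).IsDeligneLattice τ (Submodule.span FormalDisk {unitOne τ k}) := by
  refine isDeligneLattice_iff.2 ⟨⟨⟨{unitOne τ k}, by simp⟩, ?_, ?_⟩, ?_⟩
  · rw [eq_top_iff]
    intro y _
    rw [← unitVal_smul_one y]
    exact Submodule.smul_mem _ _ (Submodule.subset_span (Submodule.subset_span rfl))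
  · intro x hx
    obtain ⟨f, rfl⟩ := Submodule.mem_span_singleton.1 hx
    rw [qnabla_disk_smul_unitOne]
    exact Submodule.smul_mem _ _ (Submodule.mem_span_singleton_self _)
  · rintro μ ⟨x, hx, hxq, hμ⟩
    obtain ⟨f, rfl⟩ := Submodule.mem_span_singleton.1 hx
    obtain ⟨y, hy, h⟩ := mem_qMul.1 hμ
    obtain ⟨g, rfl⟩ := Submodule.mem_span_singleton.1 hy
    rw [qnabla_disk_smul_unitOne, complex_smul, smul_smul, smul_smul, ← sub_smul] at h
    have h' := congrArg (unitVal τ k τ) h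
    rw [unitVal_disk_smul_one, unitVal_disk_smul_one] at h'
    -- Constant terms give `μ f(0) = 0`; `f(0) = 0` would put the eigenvector in `q L`, so `μ = 0`.
    have h0 := congrArg PowerSeries.constantCoeff (IsFractionRing.injective _ _ h')
    simp only [map_sub, map_mul, PowerSeries.constantCoeff_X, PowerSeries.constantCoeff_C, zero_mul,
      zero_sub, neg_eq_zero, mul_eq_zero] at h0
    rcases h0 with h0 | h0
    · simp [h0]
    · refine absurd ?_ hxq
      rw [PowerSeries.eq_X_mul_shift_add_const f, h0, map_zero, add_zero, mul_smul,
        X_smul_mem_qMul]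
      exact Submodule.smul_mem _ _ (Submodule.mem_span_singleton_self _)

theorem mem_deligneLattice_unit (y : (unit τ k).carrier τ) :
    y ∈ (unit τ k).deligneLattice τ ↔ ∃ f : FormalDisk, f • unitOne τ k = y := by
  rw [(isDeligneLattice_unit τ k).eq_deligneLattice, Submodule.mem_span_singleton]

theorem unit_isRegularSingular (τ : ZMod 2) (k : ℤ) : (unit τ k).IsRegularSingular := by
  intro σ
  by_cases h : σ = τ
  · subst h
    exact ⟨_, (isDeligneLattice_unit σ k).toIsLogLattice⟩
  · have := unit_subsingleton (k := k) h
    refine ⟨⊥, Submodule.fg_bot, Subsingleton.elim _ _, fun x _ => ?_⟩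
    rw [Subsingleton.elim ((unit τ k).qnabla σ x) 0]
    exact Submodule.zero_mem _

end Unit

/-! ### Hodge lifts, flat lifts and their differences. -/

variable {V : VHS.{u}} {τ : ZMod 2} {k : ℤ}

theorem laurent_zero_smul {σ : ZMod 2} (x : V.carrier σ) : (0 : PuncturedDisk) • x = 0 :=
  zero_smul PuncturedDisk x

theorem mem_latticeFil {σ : ZMod 2} {p : ℤ} {x : V.carrier σ} :
    x ∈ V.latticeFil σ p ↔ x ∈ V.fil σ p ∧ x ∈ V.deligneLattice σ := Iff.rfl

theorem jacobianMk_eq_iff {x y : V.deligneLattice τ} :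
    V.jacobianMk τ k x = V.jacobianMk τ k y ↔
      ∃ s ∈ V.latticeFil τ k, ∃ t ∈ V.deligneLattice τ, V.nabla τ t = 0 ∧
        (y : V.carrier τ) = x + s + t := by
  rw [jacobianMk, jacobianMk, QuotientAddGroup.eq, jacobianRelations, AddSubgroup.mem_comap,
    AddSubgroup.mem_sup]
  change (∃ s ∈ _, ∃ t ∈ _, s + t = -(x : V.carrier τ) + y) ↔ _
  constructor
  · rintro ⟨s, hs, t, ht, h⟩
    exact ⟨s, hs, t, ht.2, ht.1, by rw [add_assoc, h, add_neg_cancel_left]⟩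
  · rintro ⟨s, hs, t, ht, ht0, h⟩
    exact ⟨s, hs, t, ⟨ht0, ht⟩, by rw [h, add_assoc, neg_add_cancel_left]⟩

namespace Extension

variable (E : Extension V τ k)

theorem value_eq (w : E.W.carrier τ) : E.value w = unitVal τ k τ (E.b.map τ w) := rfl

theorem value_add (w w' : E.W.carrier τ) : E.value (w + w') = E.value w + E.value w' := by
  simp only [value_eq, map_add]

theorem value_sub (w w' : E.W.carrier τ) : E.value (w - w') = E.value w - E.value w' := by
  simp only [value_eq, map_sub]

theorem value_smul (r : PuncturedDisk) (w : E.W.carrier τ) : E.value (r • w) = r * E.value w := by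
  simp only [value_eq, map_smul, smul_eq_mul]

theorem b_a (σ : ZMod 2) (v : V.carrier σ) : E.b.map σ (E.a.map σ v) = 0 := by
  rw [← LinearMap.mem_ker, ← E.exact]
  exact ⟨v, rfl⟩

theorem value_a (v : V.carrier τ) : E.value (E.a.map τ v) = 0 := by
  rw [value_eq, b_a, map_zero]

theorem exists_a_eq {σ : ZMod 2} {w : E.W.carrier σ} (h : E.b.map σ w = 0) :
    ∃ v, E.a.map σ v = w := by
  rw [← LinearMap.mem_ker, ← E.exact] at h
  exact h

theorem exists_a_eq_of_value {w : E.W.carrier τ} (h : E.value w = 0) :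
    ∃ v, E.a.map τ v = w :=
  E.exists_a_eq (unitVal_injective (by rw [map_zero]; exact h))

theorem a_mem_fil_iff {σ : ZMod 2} {p : ℤ} {v : V.carrier σ} :
    E.a.map σ v ∈ E.W.fil σ p ↔ v ∈ V.fil σ p :=
  ⟨E.strict_left σ p v, E.a.map_fil σ p v⟩

variable {E}

theorem IsRegularSingular.a_mem_deligneLattice_iff (hE : E.IsRegularSingular) {σ : ZMod 2}
    {v : V.carrier σ} : E.a.map σ v ∈ E.W.deligneLattice σ ↔ v ∈ V.deligneLattice σ :=
  (hE.middle.mem_deligneLattice_of_injective (E.a.map σ) (E.a.map_nabla σ) (E.injective σ)).symm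

theorem IsRegularSingular.a_mem_latticeFil_iff (hE : E.IsRegularSingular) {σ : ZMod 2} {p : ℤ}
    {v : V.carrier σ} : E.a.map σ v ∈ E.W.latticeFil σ p ↔ v ∈ V.latticeFil σ p := by
  rw [mem_latticeFil, mem_latticeFil, E.a_mem_fil_iff, hE.a_mem_deligneLattice_iff]

/-- This is where surjectivity on filtered Deligne lattices enters: a lift of `1` to the Hodge step
alone could have a pole. -/
theorem IsRegularSingular.exists_isHodgeLift (hE : E.IsRegularSingular) :
    ∃ f, E.IsHodgeLift f := by
  obtain ⟨f, hf, h⟩ := hE.lattice_strict τ k (unitOne τ k)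
    (mem_latticeFil.2 ⟨(mem_unit_fil _).2 (Or.inl le_rfl),
      (mem_deligneLattice_unit _).2 ⟨1, one_smul _ _⟩⟩)
  exact ⟨f, hf, by rw [value_eq, h, unitVal_one]⟩

/-- `x` is the difference of a Hodge lift and a flat lift of `1`. -/
def IsDifference (E : Extension V τ k) (x : V.carrier τ) : Prop :=
  ∃ h, E.IsFlatLift h ∧ E.IsHodgeLift (E.a.map τ x + h)

theorem IsHodgeLift.exists_sub_eq (hE : E.IsRegularSingular) {f h : E.W.carrier τ}
    (hf : E.IsHodgeLift f) (hh : E.IsFlatLift h) :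
    ∃ x ∈ V.deligneLattice τ, E.a.map τ x = f - h ∧ E.IsDifference x := by
  obtain ⟨x, hx⟩ := E.exists_a_eq_of_value (w := f - h)
    (by rw [value_sub, hf.value_eq, hh.value_eq, sub_self])
  refine ⟨x, ?_, hx, h, hh, by rwa [hx, sub_add_cancel]⟩
  rw [← hE.a_mem_deligneLattice_iff, hx]
  exact Submodule.sub_mem _ hf.mem.2 hh.mem

theorem nabla_eq_zero_of_a {v : V.carrier τ} (h : E.W.nabla τ (E.a.map τ v) = 0) :
    V.nabla τ v = 0 :=
  E.injective τ (by rw [E.a.map_nabla, h, map_zero])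

/-- Two Hodge lifts differ by `a s` and two flat lifts by `a t`; strictness of `a` on filtrations
and lattices places `s` in step `k` and `t` among the flat sections of the lattice of `V`. -/
theorem IsDifference.jacobianMk_eq (hE : E.IsRegularSingular) {x y : V.deligneLattice τ}
    (hx : E.IsDifference x) (hy : E.IsDifference y) :
    V.jacobianMk τ k x = V.jacobianMk τ k y := by
  obtain ⟨h, hh, hf⟩ := hx
  obtain ⟨h', hh', hf'⟩ := hy
  obtain ⟨s, hs⟩ := E.exists_a_eq_of_value (w := (E.a.map τ y + h') - (E.a.map τ x + h))
    (by rw [value_sub, hf'.value_eq, hf.value_eq, sub_self])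
  obtain ⟨t, ht⟩ := E.exists_a_eq_of_value (w := h - h')
    (by rw [value_sub, hh'.value_eq, hh.value_eq, sub_self])
  refine jacobianMk_eq_iff.2 ⟨s, ?_, t, ?_, nabla_eq_zero_of_a (E := E) ?_, E.injective τ ?_⟩
  · rw [← hE.a_mem_latticeFil_iff, hs]
    exact Submodule.sub_mem _ hf'.mem hf.mem
  · rw [← hE.a_mem_deligneLattice_iff, ht]
    exact Submodule.sub_mem _ hh.mem hh'.mem
  · rw [ht, map_sub, (qnabla_eq_zero_iff _).1 hh.flat, (qnabla_eq_zero_iff _).1 hh'.flat, sub_self]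
  · rw [map_add, map_add, hs, ht]
    abel

/-- The flat part of the change is absorbed in the flat lift and the Hodge part in the Hodge lift,
so every representative of the class is itself a difference. -/
theorem IsDifference.of_jacobianMk_eq (hE : E.IsRegularSingular) {x y : V.deligneLattice τ}
    (hx : E.IsDifference x) (hxy : V.jacobianMk τ k x = V.jacobianMk τ k y) :
    E.IsDifference y := by
  obtain ⟨h, hh, hf⟩ := hx
  obtain ⟨s, hs, t, ht, ht0, hy⟩ := jacobianMk_eq_iff.1 hxy
  refine ⟨h - E.a.map τ t, ⟨?_, ?_, ?_⟩, ?_, ?_⟩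
  · exact Submodule.sub_mem _ hh.mem (hE.a_mem_deligneLattice_iff.2 ht)
  · rw [qnabla_eq_zero_iff, map_sub, (qnabla_eq_zero_iff _).1 hh.flat, ← E.a.map_nabla, ht0,
      map_zero, sub_zero]
  · rw [value_sub, hh.value_eq, value_a, sub_zero]
  · have e : E.a.map τ y + (h - E.a.map τ t) = (E.a.map τ x + h) + E.a.map τ s := by
      rw [hy, map_add, map_add]
      abel
    rw [e]
    exact Submodule.add_mem _ hf.mem (hE.a_mem_latticeFil_iff.2 hs)
  · rw [value_add, value_sub, hh.value_eq, value_a, value_a, sub_zero, zero_add]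

/-- As `h` is flat, `a x` and the Hodge lift `a x + h` have the same derivative, and Griffiths
transversality applies to the latter. -/
theorem IsDifference.qnabla_mem (hV : V.IsRegularSingular) {x : V.deligneLattice τ}
    (hx : E.IsDifference x) : V.qnabla τ x ∈ V.latticeFil τ (k - 1) := by
  obtain ⟨h, hh, hf⟩ := hx
  refine ⟨?_, (hV.isDeligneLattice τ).stable _ x.2⟩
  refine E.strict_left τ (k - 1) _ ?_
  have e : E.a.map τ (V.qnabla τ x) = E.W.qnabla τ (E.a.map τ x + h) := by
    rw [qnabla_add, hh.flat, add_zero, map_qnabla (E.a.map_nabla τ)]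
  rw [e]
  exact Submodule.smul_mem _ (algebraMap FormalDisk PuncturedDisk PowerSeries.X)
    (E.W.griffiths τ k _ hf.mem.1)

/-- A Hodge lift splits the filtration: `b` reads off the condition on `r`, and strictness of `a`
then the one on `v`. -/
theorem add_smul_mem_fil_iff {x : V.carrier τ} {h : E.W.carrier τ}
    (hf : E.IsHodgeLift (E.a.map τ x + h)) (p : ℤ) (v : V.carrier τ) (r : PuncturedDisk) :
    E.a.map τ v + r • (E.a.map τ x + h) ∈ E.W.fil τ p ↔ v ∈ V.fil τ p ∧ (p ≤ k ∨ r = 0) := by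
  have hmem : p ≤ k ∨ r = 0 → r • (E.a.map τ x + h) ∈ E.W.fil τ p := by
    rintro (hp | hr)
    · exact Submodule.smul_mem _ _ (E.W.fil_antitone τ hp hf.mem.1)
    · have e : r • (E.a.map τ x + h) = 0 := by rw [hr, laurent_zero_smul]
      rw [e]
      exact Submodule.zero_mem _
  constructor
  · intro hw
    have hr : p ≤ k ∨ r = 0 := by
      have := (mem_unit_fil _).1 (E.b.map_fil τ p _ hw)
      rwa [← value_eq, value_add, value_smul, value_a, hf.value_eq, zero_add, mul_one] at this
    refine ⟨?_, hr⟩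
    rw [← E.a_mem_fil_iff]
    exact (Submodule.add_mem_iff_left _ (hmem hr)).1 hw
  · rintro ⟨hv, hr⟩
    exact Submodule.add_mem _ (E.a_mem_fil_iff.2 hv) (hmem hr)

theorem exists_eq_add_smul (w : E.W.carrier τ) {f : E.W.carrier τ} (hf : E.value f = 1) :
    ∃ (v : V.carrier τ) (r : PuncturedDisk), w = E.a.map τ v + r • f := by
  obtain ⟨v, hv⟩ := E.exists_a_eq_of_value (w := w - E.value w • f)
    (by rw [value_sub, value_smul, hf, mul_one, sub_self])
  exact ⟨v, E.value w, by rw [hv, sub_add_cancel]⟩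

theorem mem_fil_iff {x : V.carrier τ} {h : E.W.carrier τ}
    (hf : E.IsHodgeLift (E.a.map τ x + h)) (p : ℤ) (w : E.W.carrier τ) :
    w ∈ E.W.fil τ p ↔ ∃ y ∈ V.fil τ p, ∃ r : PuncturedDisk, (p ≤ k ∨ r = 0) ∧
      w = E.a.map τ y + r • (E.a.map τ x + h) := by
  constructor
  · intro hw
    obtain ⟨v, r, rfl⟩ := exists_eq_add_smul w hf.value_eq
    obtain ⟨hv, hr⟩ := (add_smul_mem_fil_iff hf p v r).1 hw
    exact ⟨v, hv, r, hr, rfl⟩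
  · rintro ⟨v, hv, r, hr, rfl⟩
    exact (add_smul_mem_fil_iff hf p v r).2 ⟨hv, hr⟩

/-! ### Extensions with a common difference are isomorphic. -/

/-- The splitting `V ⊕ R ≃ W` given by a lift of `1`. -/
noncomputable def splitting (E : Extension V τ k) (f : E.W.carrier τ) (hf : E.value f = 1) :
    (V.carrier τ × PuncturedDisk) ≃ₗ[PuncturedDisk] E.W.carrier τ :=
  LinearEquiv.ofBijective
    ((E.a.map τ).coprod (LinearMap.toSpanSingleton PuncturedDisk (E.W.carrier τ) f)) (by
      constructor
      · rw [← LinearMap.ker_eq_bot, LinearMap.ker_eq_bot']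
        rintro ⟨v, r⟩ h
        replace h : E.a.map τ v + r • f = 0 := h
        have hr := congrArg E.value h
        rw [value_add, value_a, value_smul, hf, zero_add, mul_one] at hr
        have h0 : r = 0 := by rw [hr, value_eq, map_zero, map_zero]
        have e : r • f = 0 := by rw [h0, laurent_zero_smul]
        rw [e, add_zero] at h
        rw [h0, E.injective τ (h.trans (map_zero _).symm)]
        rfl
      · intro w
        obtain ⟨v, r, rfl⟩ := exists_eq_add_smul w hf
        exact ⟨(v, r), by simp⟩)

theorem splitting_apply (f : E.W.carrier τ) (hf : E.value f = 1) (v : V.carrier τ)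
    (r : PuncturedDisk) : E.splitting f hf (v, r) = E.a.map τ v + r • f := rfl

theorem exists_component_equiv {E E' : Extension V τ k} {x : V.carrier τ}
    (hx : E.IsDifference x) (hx' : E'.IsDifference x) (σ : ZMod 2) :
    ∃ e : E.W.carrier σ ≃ₗ[PuncturedDisk] E'.W.carrier σ,
      (∀ w, e (E.W.nabla σ w) = E'.W.nabla σ (e w)) ∧
      (∀ p w, e w ∈ E'.W.fil σ p ↔ w ∈ E.W.fil σ p) ∧
      (∀ v, e (E.a.map σ v) = E'.a.map σ v) ∧
      ∀ w, E'.b.map σ (e w) = E.b.map σ w := by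
  by_cases hσ : σ = τ
  · subst hσ
    obtain ⟨h, hh, hf⟩ := hx
    obtain ⟨h', hh', hf'⟩ := hx'
    -- The isomorphism matches the two Hodge lifts, hence the filtrations.
    let e := (E.splitting (E.a.map σ x + h) hf.value_eq).symm.trans
      (E'.splitting (E'.a.map σ x + h') hf'.value_eq)
    have he : ∀ (v : V.carrier σ) (r : PuncturedDisk), e (E.a.map σ v + r • (E.a.map σ x + h))
        = E'.a.map σ v + r • (E'.a.map σ x + h') := by
      intro v r
      rw [← splitting_apply _ hf.value_eq, LinearEquiv.trans_apply, LinearEquiv.symm_apply_apply,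
        splitting_apply]
    -- In the coordinates `(v, r)` the connection involves only `V` and `x`, because the lift `g` is
    -- flat; so it agrees on both sides.
    have hn : ∀ {F : Extension V σ k} {g : F.W.carrier σ}, F.IsFlatLift g →
        ∀ (v : V.carrier σ) (r : PuncturedDisk),
        F.W.nabla σ (F.a.map σ v + r • (F.a.map σ x + g))
          = F.a.map σ (V.nabla σ v + r • V.nabla σ x)
            + LaurentSeries.derivative ℂ r • (F.a.map σ x + g) := by
      intro F g hg v r
      rw [map_add, F.W.leibniz, map_add (F.W.nabla σ), (qnabla_eq_zero_iff _).1 hg.flat, add_zero,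
        map_add (F.a.map σ), map_smul, F.a.map_nabla, F.a.map_nabla]
      abel
    refine ⟨e, fun w => ?_, fun p w => ?_, fun v => ?_, fun w => ?_⟩
    · obtain ⟨v, r, rfl⟩ := exists_eq_add_smul w hf.value_eq
      rw [hn hh, he, he, hn hh']
    · obtain ⟨v, r, rfl⟩ := exists_eq_add_smul w hf.value_eq
      rw [he, add_smul_mem_fil_iff hf', add_smul_mem_fil_iff hf]
    · have h0 := he v 0
      rwa [laurent_zero_smul, laurent_zero_smul, add_zero, add_zero] at h0
    · obtain ⟨v, r, rfl⟩ := exists_eq_add_smul w hf.value_eq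
      refine unitVal_injective ?_
      rw [he, ← value_eq, ← value_eq, value_add, value_add, value_smul, value_smul, value_a,
        value_a, hf.value_eq, hf'.value_eq]
  · have := unit_subsingleton (k := k) hσ
    -- In the other parity `R` vanishes and `a` is an isomorphism.
    have hb : ∀ F : Extension V τ k, Function.Bijective (F.a.map σ) := fun F =>
      ⟨F.injective σ, fun w => F.exists_a_eq (Subsingleton.elim _ _)⟩
    let e := (LinearEquiv.ofBijective (E.a.map σ) (hb E)).symm.trans
      (LinearEquiv.ofBijective (E'.a.map σ) (hb E'))
    have he : ∀ v, e (E.a.map σ v) = E'.a.map σ v := by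
      intro v
      have := (LinearEquiv.ofBijective (E.a.map σ) (hb E)).symm_apply_apply v
      rw [LinearEquiv.ofBijective_apply] at this
      rw [LinearEquiv.trans_apply, this, LinearEquiv.ofBijective_apply]
    refine ⟨e, fun w => ?_, fun p w => ?_, he, fun w => Subsingleton.elim _ _⟩
    · obtain ⟨v, rfl⟩ := (hb E).2 w
      rw [← E.a.map_nabla, he, he, E'.a.map_nabla]
    · obtain ⟨v, rfl⟩ := (hb E).2 w
      rw [he, a_mem_fil_iff, a_mem_fil_iff]

theorem IsDifference.nonempty_iso {E E' : Extension V τ k} {x : V.carrier τ}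
    (hx : E.IsDifference x) (hx' : E'.IsDifference x) : Nonempty (Iso E E') := by
  choose e h1 h2 h3 h4 using fun σ => exists_component_equiv hx hx' σ
  exact ⟨⟨e, h1, h2, h3, h4⟩⟩

theorem IsDifference.of_iso {E E' : Extension V τ k} (hE : E.IsRegularSingular)
    (hE' : E'.IsRegularSingular) (e : Iso E E') {x : V.carrier τ} (hx : E.IsDifference x) :
    E'.IsDifference x := by
  obtain ⟨h, hh, hf⟩ := hx
  have hmem : ∀ w ∈ E.W.deligneLattice τ, e.equiv τ w ∈ E'.W.deligneLattice τ := fun w hw =>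
    hE.middle.map_mem_deligneLattice hE'.middle (e.equiv τ).toLinearMap (e.map_nabla τ) hw
  have hval : ∀ w, E'.value (e.equiv τ w) = E.value w := fun w => by
    rw [value_eq, e.comp_b, value_eq]
  have hx : E'.a.map τ x + e.equiv τ h = e.equiv τ (E.a.map τ x + h) := by
    rw [map_add, e.comp_a]
  refine ⟨e.equiv τ h, ⟨hmem _ hh.mem, ?_, by rw [hval, hh.value_eq]⟩, ?_, ?_⟩
  · rw [qnabla_eq_zero_iff, ← e.map_nabla, (qnabla_eq_zero_iff _).1 hh.flat, map_zero]
  · rw [hx]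
    exact ⟨(e.map_fil τ k _).2 hf.mem.1, hmem _ hf.mem.2⟩
  · rw [hx, hval, hf.value_eq]

end Extension

/-! ### The extension attached to a normal function. -/

theorem IsLogLattice.sup_map {U : VHS.{v}} {W : VHS.{u}} {σ : ZMod 2}
    {L : Submodule FormalDisk (V.carrier σ)} {M : Submodule FormalDisk (U.carrier σ)}
    (hL : V.IsLogLattice σ L) (hM : U.IsLogLattice σ M)
    (i : V.carrier σ →ₗ[PuncturedDisk] W.carrier σ)
    (hi : ∀ x, i (V.nabla σ x) = W.nabla σ (i x))
    (j : U.carrier σ →ₗ[PuncturedDisk] W.carrier σ)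
    (hj : ∀ x, j (U.nabla σ x) = W.nabla σ (j x)) (hij : ∀ w, ∃ x y, w = i x + j y) :
    W.IsLogLattice σ
      (L.map (i.restrictScalars FormalDisk) ⊔ M.map (j.restrictScalars FormalDisk)) where
  fg := (hL.fg.map _).sup (hM.fg.map _)
  span := by
    refine eq_top_iff.2 fun w _ => ?_
    obtain ⟨x, y, rfl⟩ := hij w
    have hx : x ∈ Submodule.span PuncturedDisk (L : Set (V.carrier σ)) :=
      hL.span ▸ Submodule.mem_top
    have hy : y ∈ Submodule.span PuncturedDisk (M : Set (U.carrier σ)) :=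
      hM.span ▸ Submodule.mem_top
    refine Submodule.add_mem _ ?_ ?_
    · refine Submodule.span_le (p := (Submodule.span PuncturedDisk _).comap i).2 ?_ hx
      exact fun x hx => Submodule.subset_span (Submodule.mem_sup_left ⟨x, hx, rfl⟩)
    · refine Submodule.span_le (p := (Submodule.span PuncturedDisk _).comap j).2 ?_ hy
      exact fun y hy => Submodule.subset_span (Submodule.mem_sup_right ⟨y, hy, rfl⟩)
  stable w hw := by
    obtain ⟨_, ⟨x, hx, rfl⟩, _, ⟨y, hy, rfl⟩, rfl⟩ := Submodule.mem_sup.1 hw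
    rw [qnabla_add]
    refine Submodule.add_mem _ (Submodule.mem_sup_left ?_) (Submodule.mem_sup_right ?_)
    · exact ⟨_, hL.stable x hx, map_qnabla hi x⟩
    · exact ⟨_, hM.stable y hy, map_qnabla hj y⟩

section Twist

variable (V τ k)

/-- The filtration `F^{≥ p} V + F^{≥ p} R • (x, 1)` of `V ⊕ R`. -/
noncomputable def twistedFil (x : ∀ σ, V.carrier σ) (σ : ZMod 2) (p : ℤ) :
    Submodule PuncturedDisk (V.carrier σ × (unit τ k).carrier σ) :=
  (V.fil σ p).comap (LinearMap.fst PuncturedDisk _ _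
      - ((unitVal τ k σ).smulRight (x σ)).comp (LinearMap.snd PuncturedDisk _ _))
    ⊓ ((unit τ k).fil σ p).comap (LinearMap.snd PuncturedDisk _ _)

variable {V τ k} in
theorem mem_twistedFil {x : ∀ σ, V.carrier σ} {σ : ZMod 2} {p : ℤ}
    {w : V.carrier σ × (unit τ k).carrier σ} :
    w ∈ V.twistedFil τ k x σ p ↔
      w.1 - unitVal τ k σ w.2 • x σ ∈ V.fil σ p ∧ w.2 ∈ (unit τ k).fil σ p := Iff.rfl

variable {V τ k} in
theorem inl_mem_twistedFil {x : ∀ σ, V.carrier σ} {σ : ZMod 2} {p : ℤ} {v : V.carrier σ} :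
    ((v, 0) : V.carrier σ × (unit τ k).carrier σ) ∈ V.twistedFil τ k x σ p ↔ v ∈ V.fil σ p := by
  rw [mem_twistedFil, map_zero, laurent_zero_smul, sub_zero]
  exact and_iff_left (Submodule.zero_mem _)

variable {V τ k} in
-- Differentiating `v - r x` leaves the extra term `r ∇ x`. It is harmless: either `p ≤ k` and `∇ x`
-- is in step `k - 1`, contained in step `p - 1`, or `r = 0`.
theorem nabla_mem_twistedFil {x : ∀ σ, V.carrier σ}
    (hx : ∀ σ, V.nabla σ (x σ) ∈ V.fil σ (k - 1)) {σ : ZMod 2} {p : ℤ}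
    {w : V.carrier σ × (unit τ k).carrier σ} (hw : w ∈ V.twistedFil τ k x σ p) :
    (V.nabla σ w.1, (unit τ k).nabla σ w.2) ∈ V.twistedFil τ k x σ (p - 1) := by
  obtain ⟨h1, h2⟩ := mem_twistedFil.1 hw
  refine mem_twistedFil.2 ⟨?_, (unit τ k).griffiths σ p _ h2⟩
  have e : V.nabla σ w.1 - LaurentSeries.derivative ℂ (unitVal τ k σ w.2) • x σ
      = V.nabla σ (w.1 - unitVal τ k σ w.2 • x σ) + unitVal τ k σ w.2 • V.nabla σ (x σ) := by
    rw [map_sub, V.leibniz]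
    abel
  rw [unitVal_nabla, e]
  refine Submodule.add_mem _ (V.griffiths σ p _ h1) ?_
  rcases (mem_unit_fil _).1 h2 with hp | hr
  · exact Submodule.smul_mem _ _ (V.fil_antitone σ (by omega) (hx σ))
  · have e : unitVal τ k σ w.2 • V.nabla σ (x σ) = 0 := by
      rw [hr, laurent_zero_smul]
    rw [e]
    exact Submodule.zero_mem _

/-- The VHS `V ⊕ R` with the Hodge filtration `F^{≥ p} V + F^{≥ p} R • (x, 1)`. -/
noncomputable def twistedSum (x : ∀ σ, V.carrier σ)
    (hx : ∀ σ, V.nabla σ (x σ) ∈ V.fil σ (k - 1)) : VHS.{u} where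
  carrier σ := V.carrier σ × (unit τ k).carrier σ
  nabla σ := (V.nabla σ).prodMap ((unit τ k).nabla σ)
  leibniz σ r w := Prod.ext (V.leibniz σ r w.1) ((unit τ k).leibniz σ r w.2)
  fil σ p := V.twistedFil τ k x σ p
  fil_antitone σ _ _ h :=
    inf_le_inf (Submodule.comap_mono (V.fil_antitone σ h))
      (Submodule.comap_mono ((unit τ k).fil_antitone σ h))
  griffiths _ _ _ hw := nabla_mem_twistedFil hx hw

variable {V τ k}
variable {x : ∀ σ, V.carrier σ} {hx : ∀ σ, V.nabla σ (x σ) ∈ V.fil σ (k - 1)}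

variable (hx) in
/-- The extension of `R` by `V` with middle term `twistedSum`. -/
noncomputable def twistedExtension : Extension V τ k where
  W := V.twistedSum τ k x hx
  a :=
    { map := fun σ => LinearMap.inl PuncturedDisk (V.carrier σ) ((unit τ k).carrier σ)
      map_nabla := fun σ v => Prod.ext rfl (map_zero ((unit τ k).nabla σ)).symm
      map_fil := fun σ p v hv => inl_mem_twistedFil.2 hv }
  b :=
    { map := fun σ => LinearMap.snd PuncturedDisk (V.carrier σ) ((unit τ k).carrier σ)
      map_nabla := fun σ w => rfl
      map_fil := fun σ p w hw => (mem_twistedFil.1 hw).2 }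
  injective σ := LinearMap.inl_injective
  exact σ := LinearMap.range_inl _ _ _
  surjective σ := LinearMap.snd_surjective
  strict_left _ _ _ hv := inl_mem_twistedFil.1 hv
  strict_right σ p y hy :=
    ⟨(unitVal τ k σ y • x σ, y), mem_twistedFil.2 ⟨by simp, hy⟩, rfl⟩

/-- The horizontal splitting of `twistedExtension`. -/
noncomputable def twistedSection (hx : ∀ σ, V.nabla σ (x σ) ∈ V.fil σ (k - 1)) (σ : ZMod 2) :
    (unit τ k).carrier σ →ₗ[PuncturedDisk] (twistedExtension hx : Extension V τ k).W.carrier σ :=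
  LinearMap.inr PuncturedDisk (V.carrier σ) ((unit τ k).carrier σ)

theorem twistedSection_nabla (σ : ZMod 2) (y : (unit τ k).carrier σ) :
    twistedSection hx σ ((unit τ k).nabla σ y)
      = (twistedExtension hx : Extension V τ k).W.nabla σ (twistedSection hx σ y) :=
  Prod.ext (map_zero (V.nabla σ)).symm rfl

theorem twistedSum_isRegularSingular (hV : V.IsRegularSingular) :
    (twistedExtension hx : Extension V τ k).W.IsRegularSingular := by
  intro σ
  obtain ⟨L, hL⟩ := hV σ
  obtain ⟨M, hM⟩ := unit_isRegularSingular τ k σ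
  refine ⟨_, hL.sup_map hM ((twistedExtension hx).a.map σ) ((twistedExtension hx).a.map_nabla σ)
    (twistedSection hx σ) (twistedSection_nabla σ) fun w => ⟨w.1, w.2, ?_⟩⟩
  exact Prod.ext (add_zero w.1).symm (zero_add w.2).symm

theorem twistedSection_mem_deligneLattice (hV : V.IsRegularSingular) {σ : ZMod 2}
    {y : (unit τ k).carrier σ} (hy : y ∈ (unit τ k).deligneLattice σ) :
    twistedSection hx σ y ∈ (twistedExtension hx : Extension V τ k).W.deligneLattice σ :=
  (unit_isRegularSingular τ k).map_mem_deligneLattice (twistedSum_isRegularSingular hV) _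
    (twistedSection_nabla σ) hy

/-- The element is `y • (x, 1)`, which lies in the twisted filtration by construction; it lies in
the lattice because `x` does and the splitting of `R` is horizontal. -/
theorem twistedLift_mem_latticeFil (hV : V.IsRegularSingular)
    (hxL : ∀ σ, x σ ∈ V.deligneLattice σ) {p : ℤ}
    {y : (unit τ k).carrier τ} (hy : y ∈ (unit τ k).latticeFil τ p) :
    (twistedExtension hx).a.map τ (unitVal τ k τ y • x τ) + twistedSection hx τ y
      ∈ (twistedExtension hx : Extension V τ k).W.latticeFil τ p := by
  refine ⟨?_, Submodule.add_mem _ ?_ (twistedSection_mem_deligneLattice hV hy.2)⟩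
  · have h : (unitVal τ k τ y • x τ + 0, 0 + y) ∈ V.twistedFil τ k x τ p := by
      rw [add_zero, zero_add]
      exact mem_twistedFil.2 ⟨by simp, hy.1⟩
    exact h
  · refine hV.map_mem_deligneLattice (twistedSum_isRegularSingular hV) _
      ((twistedExtension hx).a.map_nabla τ) ?_
    obtain ⟨f, rfl⟩ := (mem_deligneLattice_unit y).1 hy.2
    rw [unitVal_disk_smul_one]
    exact Submodule.smul_mem _ f (hxL τ)

theorem twistedExtension_isRegularSingular (hV : V.IsRegularSingular)
    (hxL : ∀ σ, x σ ∈ V.deligneLattice σ) :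
    (twistedExtension hx : Extension V τ k).IsRegularSingular where
  left := hV
  middle := twistedSum_isRegularSingular hV
  lattice_strict σ p y hy := by
    by_cases hσ : σ = τ
    · subst hσ
      exact ⟨_, twistedLift_mem_latticeFil (hx := hx) hV hxL hy, zero_add y⟩
    · have := unit_subsingleton (k := k) hσ
      exact ⟨0, Submodule.zero_mem _, Subsingleton.elim _ _⟩

theorem twistedSection_one_isFlatLift (hV : V.IsRegularSingular) :
    (twistedExtension hx).IsFlatLift (twistedSection hx τ (unitOne τ k)) where
  mem := twistedSection_mem_deligneLattice hV ((mem_deligneLattice_unit _).2 ⟨1, one_smul _ _⟩)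
  flat := by
    have := qnabla_disk_smul_unitOne (τ := τ) (k := k) 1
    rw [one_smul, Derivation.map_one_eq_zero, mul_zero, zero_smul] at this
    rw [← map_qnabla (twistedSection_nabla τ), this, map_zero]
  value_eq := rfl

theorem twistedExtension_isDifference (hV : V.IsRegularSingular)
    (hxL : ∀ σ, x σ ∈ V.deligneLattice σ) :
    (twistedExtension hx : Extension V τ k).IsDifference (x τ) := by
  refine ⟨_, twistedSection_one_isFlatLift hV, ?_, ?_⟩
  · have := twistedLift_mem_latticeFil (hx := hx) hV hxL (p := k) (y := unitOne τ k)
      ⟨(mem_unit_fil _).2 (Or.inl le_rfl), (mem_deligneLattice_unit _).2 ⟨1, one_smul _ _⟩⟩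
    rwa [unitVal_one, one_smul] at this
  · rw [Extension.value_add, Extension.value_a, zero_add]
    rfl

end Twist

theorem exists_flatExtension_isDifference (hV : V.IsRegularSingular) {x : V.carrier τ}
    (hxL : x ∈ V.deligneLattice τ) (hx : V.qnabla τ x ∈ V.latticeFil τ (k - 1)) :
    ∃ E : V.FlatExtension τ k, E.1.IsDifference x := by
  -- The Hodge steps are `ℂ((q))`-submodules, so the factor `q` can be divided out.
  have h0 : V.nabla τ x ∈ V.fil τ (k - 1) := by
    have := Submodule.smul_mem _ (algebraMap FormalDisk PuncturedDisk PowerSeries.X)⁻¹ hx.1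
    rwa [qnabla, disk_smul, smul_smul, inv_mul_cancel₀ algebraMap_X_ne_zero, one_smul] at this
  -- The twist is `x` in the parity of `R` and `0` in the other.
  have h1 : ∀ σ, V.nabla σ (Pi.single (M := V.carrier) τ x σ) ∈ V.fil σ (k - 1) := by
    intro σ
    by_cases hσ : σ = τ
    · subst hσ
      rwa [Pi.single_eq_same]
    · rw [Pi.single_eq_of_ne hσ, map_zero]
      exact Submodule.zero_mem _
  have h2 : ∀ σ, Pi.single (M := V.carrier) τ x σ ∈ V.deligneLattice σ := by
    intro σ
    by_cases hσ : σ = τ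
    · subst hσ
      rwa [Pi.single_eq_same]
    · rw [Pi.single_eq_of_ne hσ]
      exact Submodule.zero_mem _
  refine ⟨⟨twistedExtension h1, twistedExtension_isRegularSingular hV h2,
    _, twistedSection_one_isFlatLift hV⟩, ?_⟩
  have := twistedExtension_isDifference (τ := τ) (hx := h1) hV h2
  rwa [Pi.single_eq_same] at this

/-! ### The bijection. -/

theorem FlatExtension.exists_isDifference (E : V.FlatExtension τ k) :
    ∃ x : V.deligneLattice τ, E.1.IsDifference x := by
  obtain ⟨f, hf⟩ := E.2.1.exists_isHodgeLift
  obtain ⟨h, hh⟩ := E.2.2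
  obtain ⟨x, hx, _, hd⟩ := hf.exists_sub_eq E.2.1 hh
  exact ⟨⟨x, hx⟩, hd⟩

/-- The class of an extension and a normal function correspond to each other. -/
theorem exists_normalFunction_equiv (hV : V.IsRegularSingular) (τ : ZMod 2) (k : ℤ) :
    ∃ Φ : V.NormalFunction τ k ≃ V.ExtensionClass τ k,
      ∀ (E : V.FlatExtension τ k) (x : V.deligneLattice τ),
        E.1.IsDifference x ↔ (Φ.symm E.toClass).1 = V.jacobianMk τ k x := by
  choose d hd using fun E : V.FlatExtension τ k => E.exists_isDifference
  let F : V.FlatExtension τ k → V.NormalFunction τ k := fun E =>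
    ⟨V.jacobianMk τ k (d E), d E, rfl, (hd E).qnabla_mem hV⟩
  have hF : ∀ E E' : V.FlatExtension τ k, (flatExtensionSetoid V τ k).r E E' → F E = F E' := by
    rintro E E' ⟨e⟩
    exact Subtype.ext (((hd E).of_iso E.2.1 E'.2.1 e).jacobianMk_eq E'.2.1 (hd E'))
  let G : V.ExtensionClass τ k → V.NormalFunction τ k := Quotient.lift F hF
  have hG : Function.Bijective G := by
    constructor
    · intro c c'
      induction c using Quotient.inductionOn with | _ E
      induction c' using Quotient.inductionOn with | _ E'
      intro h
      have h' : V.jacobianMk τ k (d E) = V.jacobianMk τ k (d E') := congrArg Subtype.val h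
      -- Equal classes make the difference chosen for `E'` a difference for `E` too, and a common
      -- difference gives an isomorphism.
      exact Quotient.sound (((hd E).of_jacobianMk_eq E.2.1 h').nonempty_iso (hd E'))
    · rintro ⟨ν, x, rfl, hx⟩
      obtain ⟨E, hE⟩ := exists_flatExtension_isDifference hV x.2 hx
      exact ⟨E.toClass, Subtype.ext ((hd E).jacobianMk_eq E.2.1 hE)⟩
  refine ⟨(Equiv.ofBijective G hG).symm, fun E x => ?_⟩
  change _ ↔ V.jacobianMk τ k (d E) = V.jacobianMk τ k x
  exact ⟨fun h => (hd E).jacobianMk_eq E.2.1 h, fun h => (hd E).of_jacobianMk_eq E.2.1 h⟩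

end VHS

theorem mainTheorem3 (V : VHS.{u}) (_P : V.Polarisation) (hV : V.IsRegularSingular)
    (τ : ZMod 2) (k : ℤ) :
    ∃ Φ : V.NormalFunction τ k ≃ V.ExtensionClass τ k,
      (∀ (E : V.FlatExtension τ k) (f h : E.1.W.carrier τ),
        E.1.IsHodgeLift f → E.1.IsFlatLift h →
          ∃ x : V.deligneLattice τ, E.1.a.map τ x = f - h ∧
            (Φ.symm E.toClass).1 = V.jacobianMk τ k x) ∧
      (∀ (ν : V.NormalFunction τ k) (x : V.deligneLattice τ), V.jacobianMk τ k x = ν.1 →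
        ∀ E : V.FlatExtension τ k, E.toClass = Φ ν →
          ∃ h : E.1.W.carrier τ, E.1.IsFlatLift h ∧
            ∀ (p : ℤ) (w : E.1.W.carrier τ), w ∈ E.1.W.fil τ p ↔
              ∃ y ∈ V.fil τ p, ∃ r : PuncturedDisk, (p ≤ k ∨ r = 0) ∧
                w = E.1.a.map τ y + r • (E.1.a.map τ x + h)) := by
  obtain ⟨Φ, hΦ⟩ := VHS.exists_normalFunction_equiv hV τ k
  refine ⟨Φ, fun E f h hf hh => ?_, fun ν x hx E hE => ?_⟩
  · obtain ⟨x, hx, hxe, hd⟩ := hf.exists_sub_eq E.2.1 hh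
    exact ⟨⟨x, hx⟩, hxe, (hΦ E ⟨x, hx⟩).1 hd⟩
  -- Any lift of `ν` is itself a difference for `E`; its Hodge lift `a x + h` splits the filtration.
  · obtain ⟨h, hh, hf⟩ := (hΦ E x).2 (by rw [hE, Equiv.symm_apply_apply, hx])
    exact ⟨h, hh, VHS.Extension.mem_fil_iff hf⟩
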